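/- Let $K$ be an algebraically closed field of characteristic zero, let $0<p<q$ be coprime integers, $n=p+q$ and $\mathfrak g=\mathfrak{sl}_n(K)$ with Killing form $\kappa$. Let $\mathfrak p$ be the derived algebra of the maximal parabolic subalgebra of $\mathfrak g$ consisting of the block lower triangular matrices with diagonal blocks of sizes $p$ (top left) and $q$. Let $\mathfrak m$ be the nilradical of this parabolic, that is, the space of matrices supported in the lower left $q\times p$ block. For a finite-dimensional Lie algebra $\mathfrak a$ and $\xi\in\mathfrak a^*$ let $\mathfrak a^\xi$ be the stabilizer of $\xi$ under the coadjoint action. Put $\operatorname{index}\mathfrak a=\min_{\xi\in\mathfrak a^*}\dim\mathfrak a^\xi$, and call $\xi$ regular if $\dim\mathfrak a^\xi=\operatorname{index}\mathfrak a$. An adapted pair for $\mathfrak a$ is a pair $(h,\eta)$ with $h\in\mathfrak a$, $\eta\in\mathfrak a^*$ regular, and $h\eta=-\eta$ for the coadjoint action. Identify $\mathfrak g^*$ with $\mathfrak g$ through $\kappa$, so that restriction to $\mathfrak p$ becomes the map $\mathfrak g\to\mathfrak p^*$, $y\mapsto\kappa(y,\cdot)|_{\mathfrak p}$. A regular nilpotent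 element of $\mathfrak g$ is an ad-nilpotent $y\in\mathfrak g$ such that $\kappa(y,\cdot)\in\mathfrak g^*$ is regular. For $1\le i\ne j\le n$ let $x_{i,j}\in\mathfrak g$ be an arbitrary non-zero root vector of weight $\varepsilon_i-\varepsilon_j$ for the diagonal Cartan subalgebra. Let $\mathscr B$ be the set of roots $\varepsilon_i-\varepsilon_j$ with $i<j$ and $i+j=n+1$ (the Kostant cascade of $\mathfrak{sl}_n$). Let $\mathscr B'$ be the set of roots $\varepsilon_i-\varepsilon_j$ with $i>j$ and either $i,j\le p$, $i+j=p+1$, or $i,j>p$, $i+j=n+p+1$ (the opposed Kostant cascade of the Levi factor). Let $\overline{\mathscr B}$ be obtained from $\mathscr B\cup\mathscr B'$ by removing its elements of the form $\pm(\varepsilon_k-\varepsilon_{k+1})$ (there is exactly one). Put $$\eta=\sum_{\varepsilon_i-\varepsilon_j\in\overline{\mathscr B}}x_{i,j}\in\mathfrak g,\qquad y_0=\sum_{k=1}^{n-1}x_{k,k+1}\in\mathfrak g .$$ Then: 1. $\operatorname{index}\mathfrak p=1$. 2. For every adapted pair $(h',\eta')$ of $\mathfrak p$ there is a regular nilpotent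 element $y$ of $\mathfrak g$ whose restriction to $\mathfrak p$ is $\eta'$. Equivalently, the set of all pre-images of $\eta'$ in $\mathfrak g^*=\mathfrak g$, a coset of the kernel of $\mathfrak g^*\to\mathfrak p^*$, contains a regular nilpotent element. 3. There is a unique diagonal matrix $h\in\mathfrak p$ such that $(h,\eta|_{\mathfrak p})$ is an adapted pair for $\mathfrak p$. 4. There is $\xi\in\mathfrak m$ such that $\eta+\xi$ is a regular nilpotent element of $\mathfrak g$ with the same restriction to $\mathfrak p$ as $\eta$. Moreover $\xi$ can be chosen so that $\eta+\xi=n_w b\,y_0$ for some $w$ in the Weyl group $W=S_n$, some representative $n_w$ of $w$ in the normalizer of the diagonal torus, and some $b$ in the group $B$ of invertible upper triangular matrices, the groups acting on $\mathfrak g$ by conjugation. In particular $\eta|_{\mathfrak p}$ is the restriction of $n_w b\,y_0$ to $\mathfrak p$. -/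

import Mathlib

noncomputable section

namespace IndexOne

open LieAlgebra LieAlgebra.SpecialLinear

/-! ### Index, regular elements and adapted pairs of a finite-dimensional Lie algebra -/

section General

variable {K : Type*} [Field K]

section Abstract

variable {L : Type*} [LieRing L] [LieAlgebra K L]

/-- The stabilizer `{a | a ξ = 0}` of `ξ ∈ L*` under the coadjoint action
`(a ξ)(b) = - ξ ⁅a, b⁆`. -/
def stabilizer (ξ : Module.Dual K L) : Submodule K L where
  carrier := {a | ⁅a, ξ⁆ = 0}
  zero_mem' := zero_lie ξ
  add_mem' := by
    intro a b ha hb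
    have ha' : ⁅a, ξ⁆ = 0 := ha
    have hb' : ⁅b, ξ⁆ = 0 := hb
    change ⁅a + b, ξ⁆ = 0
    rw [add_lie, ha', hb', add_zero]
  smul_mem' := by
    intro c a ha
    have ha' : ⁅a, ξ⁆ = 0 := ha
    change ⁅c • a, ξ⁆ = 0
    rw [smul_lie, ha', smul_zero]

variable (K L) in
/-- The index of `L`: the minimal dimension of a stabilizer of a point of `L*`. -/
def index : ℕ := ⨅ ξ : Module.Dual K L, Module.finrank K (stabilizer ξ)

/-- `ξ ∈ L*` is regular when its stabilizer has the minimal dimension. -/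
def IsRegular (ξ : Module.Dual K L) : Prop :=
  Module.finrank K (stabilizer ξ) = index K L

/-- An adapted pair `(h, η)`: `η ∈ L*` is regular, `h ∈ L` and `h η = - η` for the
coadjoint action. -/
def IsAdaptedPair (h : L) (η : Module.Dual K L) : Prop :=
  IsRegular η ∧ ⁅h, η⁆ = -η

variable (K L) in
/-- The set `𝒩(L)_reg` of regular ad-nilpotent elements of `L`; regularity refers to `L*`,
to which `L` is mapped by its Killing form. -/
def regularNilpotents : Set L :=
  {y | IsNilpotent (LieAlgebra.ad K L y) ∧ IsRegular (killingForm K L y)}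

end Abstract

variable {𝔤 : Type*} [LieRing 𝔤] [LieAlgebra K 𝔤]

/-- The restriction map `𝔤* → 𝔞*`, precomposed with the map `𝔤 → 𝔤*` given by the
Killing form of `𝔤`. -/
def restrict (𝔞 : LieSubalgebra K 𝔤) : 𝔤 →ₗ[K] Module.Dual K 𝔞 :=
  (killingForm K 𝔤).compl₂ (𝔞.incl : 𝔞 →ₗ[K] 𝔤)

/-- For every adapted pair `(h, η)` of `𝔞`, the set of all pre-images of `η` in `𝔤* = 𝔤`
(a coset of the kernel `𝔨` of `𝔤* → 𝔞*`) meets `𝒩(𝔤)_reg`. -/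
def SuggestionHolds (𝔞 : LieSubalgebra K 𝔤) : Prop :=
  ∀ (h : 𝔞) (η : Module.Dual K 𝔞), IsAdaptedPair h η →
    ∃ y : 𝔤, restrict 𝔞 y = η ∧ y ∈ regularNilpotents K 𝔤

end General

/-! ### The maximal parabolic of `sl(p+q)` and its truncation -/

section Parabolic

variable (K : Type*) [Field K] (p q : ℕ)

/-- The maximal parabolic subalgebra of `sl(p+q)` with diagonal blocks of sizes `p` (top left)
and `q`, and with nilradical in the lower left block. -/
def parabolic : LieSubalgebra K (sl (Fin (p + q)) K) where
  carrier := {x | ∀ i j : Fin (p + q), (i : ℕ) < p → p ≤ (j : ℕ) → x.val i j = 0}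
  zero_mem' := by
    intro i j _ _
    rfl
  add_mem' := by
    intro x y hx hy i j hi hj
    change x.val i j + y.val i j = 0
    rw [hx i j hi hj, hy i j hi hj, add_zero]
  smul_mem' := by
    intro c x hx i j hi hj
    change c * x.val i j = 0
    rw [hx i j hi hj, mul_zero]
  lie_mem' := by
    intro x y hx hy i j hi hj
    have key : ∀ a b : sl (Fin (p + q)) K,
        (∀ i j : Fin (p + q), (i : ℕ) < p → p ≤ (j : ℕ) → a.val i j = 0) →
        (∀ i j : Fin (p + q), (i : ℕ) < p → p ≤ (j : ℕ) → b.val i j = 0) →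
        (a.val * b.val) i j = 0 := by
      intro a b ha hb
      rw [Matrix.mul_apply]
      refine Finset.sum_eq_zero fun k _ => ?_
      rcases lt_or_ge (k : ℕ) p with hk | hk
      · rw [hb k j hk hj, mul_zero]
      · rw [ha i k hi hk, zero_mul]
    rw [sl_bracket, Matrix.sub_apply, key x y hx hy, key y x hy hx, sub_zero]

/-- The truncated parabolic `𝔭`: the derived algebra of the maximal parabolic, viewed inside
`sl(p+q)`. -/
def truncatedParabolic : LieSubalgebra K (sl (Fin (p + q)) K) :=
  (derivedSeries K (parabolic K p q) 1).toLieSubalgebra.map (parabolic K p q).incl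

/-- The nilradical `𝔪`: the matrices supported in the lower left block. -/
def lowerNilradical : Submodule K (sl (Fin (p + q)) K) where
  carrier := {x | ∀ i j : Fin (p + q), ¬ (p ≤ (i : ℕ) ∧ (j : ℕ) < p) → x.val i j = 0}
  zero_mem' := by
    intro i j _
    rfl
  add_mem' := by
    intro x y hx hy i j hij
    change x.val i j + y.val i j = 0
    rw [hx i j hij, hy i j hij, add_zero]
  smul_mem' := by
    intro c x hx i j hij
    change c * x.val i j = 0
    rw [hx i j hij, mul_zero]

end Parabolic

/-! ### Roots, root vectors and Kostant cascades

The root `ε_i - ε_j` of `sl(n)`, `i ≠ j`, is encoded by the pair `(i, j)`; indices start at `0`. -/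

section Roots

/-- The simple roots `α_i = ε_i - ε_{i+1}`. -/
def simpleRoots (n : ℕ) : Finset (Fin n × Fin n) :=
  Finset.univ.filter fun β => (β.2 : ℕ) = β.1 + 1

/-- The Kostant cascade of `sl(n)`: the positive roots `ε_i - ε_j` with `i` and `j`
exchanged by the reversal of `{0, …, n-1}`. -/
def cascade (n : ℕ) : Finset (Fin n × Fin n) :=
  Finset.univ.filter fun β => β.1 < β.2 ∧ (β.1 : ℕ) + β.2 + 1 = n

/-- The opposed Kostant cascade of the Levi factor `sl(p) × sl(q)`: the negative roots
`ε_i - ε_j` with `i` and `j` exchanged by the reversal of one of the two blocks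
`{0, …, p-1}` and `{p, …, p+q-1}`. -/
def leviCascade (p q : ℕ) : Finset (Fin (p + q) × Fin (p + q)) :=
  Finset.univ.filter fun β => β.2 < β.1 ∧
    (((β.1 : ℕ) < p ∧ (β.2 : ℕ) < p ∧ (β.1 : ℕ) + β.2 + 1 = p) ∨
      (p ≤ (β.1 : ℕ) ∧ p ≤ (β.2 : ℕ) ∧ (β.1 : ℕ) + β.2 + 1 = p + (p + q)))

/-- The union of the two cascades with every element of `π ∪ -π` removed. -/
def modifiedCascade (p q : ℕ) : Finset (Fin (p + q) × Fin (p + q)) :=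
  (cascade (p + q) ∪ leviCascade p q).filter fun β =>
    β ∉ simpleRoots (p + q) ∧ β.swap ∉ simpleRoots (p + q)

variable {K : Type*} [Field K]

/-- `y` is a non-zero vector of weight `ε_i - ε_j` for the diagonal Cartan subalgebra. -/
def IsRootVector {n : ℕ} (i j : Fin n) (y : sl (Fin n) K) : Prop :=
  y ≠ 0 ∧ ∀ h : sl (Fin n) K, h.val.IsDiag → ⁅h, y⁆ = (h.val i i - h.val j j) • y

/-- `g` normalizes the diagonal torus and induces on it the permutation `w`, that is, `g`
represents the element `w` of the Weyl group `S_n`. -/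
def IsWeylRepresentative {n : ℕ} (g : GL (Fin n) K) (w : Equiv.Perm (Fin n)) : Prop :=
  ∀ t : Fin n → K, g.val * Matrix.diagonal t * g⁻¹.val = Matrix.diagonal (t ∘ w.symm)

/-- The conjugation action of `GL_n` on `sl(n)`, through which the adjoint group acts. -/
def conj {n : ℕ} (g : GL (Fin n) K) (y : sl (Fin n) K) : sl (Fin n) K :=
  ⟨g.val * y.val * g⁻¹.val, by
    have hy : Matrix.trace y.val = 0 := LinearMap.mem_ker.1 y.property
    refine LinearMap.mem_ker.2 ?_
    change Matrix.trace (g.val * y.val * g⁻¹.val) = 0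
    rw [Matrix.trace_mul_comm, ← Matrix.mul_assoc, Units.inv_mul, Matrix.one_mul, hy]⟩

/-- The element `η = ∑ x_β` over the modified cascade, for given root vectors `x`. -/
def eta (p q : ℕ) (x : Fin (p + q) → Fin (p + q) → sl (Fin (p + q)) K) :
    sl (Fin (p + q)) K :=
  ∑ β ∈ modifiedCascade p q, x β.1 β.2

/-- The standard regular nilpotent element `y₀ = ∑ x_α` over the simple roots. -/
def standardNilpotent {n : ℕ} (x : Fin n → Fin n → sl (Fin n) K) : sl (Fin n) K :=
  ∑ α ∈ simpleRoots n, x α.1 α.2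

end Roots

end IndexOne

end

open IndexOne

/-! ### Euclidean recursion for the modified cascade -/

namespace IndexOne

/-- Induction along the subtractive Euclidean algorithm. -/
theorem coprime_induction {P : ℕ → ℕ → Prop} (base : P 1 1)
    (step : ∀ p r, 0 < p → 0 < r → Nat.Coprime p r → P p r → P p (p + r))
    (swap : ∀ p q, 0 < p → 0 < q → P p q → P q p)
    {p q : ℕ} (hp : 0 < p) (hq : 0 < q) (hco : Nat.Coprime p q) : P p q := by
  induction hn : p + q using Nat.strong_induction_on generalizing p q with
  | _ n ih =>
    have aux : ∀ {p q : ℕ}, 0 < p → p < q → Nat.Coprime p q → p + q = n → P p q := by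
      intro p q hp hpq hco hn
      obtain ⟨r, rfl⟩ := Nat.exists_eq_add_of_lt hpq
      have hco' : Nat.Coprime p (r + 1) := by
        rw [add_assoc] at hco
        simpa using hco
      have := step p (r + 1) hp (Nat.succ_pos r) hco'
        (ih (p + (r + 1)) (by omega) hp (Nat.succ_pos r) hco' rfl)
      simpa [add_assoc] using this
    rcases lt_trichotomy p q with h | h | h
    · exact aux hp h hco hn
    · subst h
      have : p = 1 := by simpa using hco
      subst this
      exact base
    · exact swap q p hq hp (aux hq h hco.symm (by omega))

/-- The modified cascade of `sl(p+q)` as a relation on natural numbers. -/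
def CascadeEdge (p q i j : ℕ) : Prop :=
  (i < j ∧ i + j + 1 = p + q ∧ j ≠ i + 1) ∨
    (j < i ∧ i ≠ j + 1 ∧
      ((i < p ∧ i + j + 1 = p) ∨ (p ≤ j ∧ i + j + 1 = p + (p + q))))

theorem mem_modifiedCascade {p q : ℕ} (i j : Fin (p + q)) :
    (i, j) ∈ modifiedCascade p q ↔ CascadeEdge p q i j := by
  simp only [modifiedCascade, cascade, leviCascade, simpleRoots, CascadeEdge, Finset.mem_filter,
    Finset.mem_union, Finset.mem_univ, true_and, Prod.fst_swap, Prod.snd_swap, Fin.lt_def]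
  omega

theorem CascadeEdge.lt {p q i j : ℕ} (h : CascadeEdge p q i j) : i < p + q ∧ j < p + q := by
  unfold CascadeEdge at h
  omega

/-- Reflection in the antidiagonal preserves the Kostant cascade and exchanges the two Levi blocks.
-/
theorem cascadeEdge_swap {p q i j : ℕ} (hi : i < p + q) (hj : j < p + q) :
    CascadeEdge q p (p + q - 1 - j) (p + q - 1 - i) ↔ CascadeEdge p q i j := by
  unfold CascadeEdge
  omega

/-- Every k < p has exactly one edge into the second block, to its mirror image 2p + r - 1 - k.
Contract these edges and number the second block backwards: its Levi edges become the cascade of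
size p + r, its cascade edges become the Levi edges of the block of size r, and the edges inside the
first block are kept. -/
theorem cascadeEdge_step {p r k l : ℕ} (hr : 0 < r) (hk : k < p + r) (hl : l < p + r) :
    CascadeEdge p r k l ↔
      CascadeEdge p (p + r) (p + (p + r) - 1 - k) (p + (p + r) - 1 - l) ∨
        (k < p ∧ l < p ∧ CascadeEdge p (p + r) k l) := by
  unfold CascadeEdge
  omega

theorem not_cascadeEdge_lower {p q i j : ℕ} (hi : p ≤ i) (hj : j < p) :
    ¬ CascadeEdge p q i j := by
  unfold CascadeEdge
  omega

/-- For r > 0 the antidiagonal avoids the position (p - 1, p), so no simple root is removed from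
this block. -/
theorem cascadeEdge_upper {p r i j : ℕ} (hr : 0 < r) (hi : i < p) (hj : p ≤ j) :
    CascadeEdge p (p + r) i j ↔ i + j + 1 = p + (p + r) := by
  unfold CascadeEdge
  omega

/-- The indices can be ordered such that all edges point forward and successive indices are
joined by an edge or belong to the lower left block. -/
theorem exists_chain {p q : ℕ} (hp : 0 < p) (hq : 0 < q) (hco : Nat.Coprime p q) :
    ∃ l : List ℕ, (∀ k, k ∈ l ↔ k < p + q) ∧
      l.Pairwise (fun a b => a ≠ b ∧ ¬ CascadeEdge p q b a) ∧
      l.IsChain (fun a b => CascadeEdge p q a b ∨ (b < p ∧ p ≤ a)) := by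
  refine coprime_induction (P := fun p q => ∃ l : List ℕ, (∀ k, k ∈ l ↔ k < p + q) ∧
      l.Pairwise (fun a b => a ≠ b ∧ ¬ CascadeEdge p q b a) ∧
      l.IsChain (fun a b => CascadeEdge p q a b ∨ (b < p ∧ p ≤ a))) ?_ ?_ ?_ hp hq hco
  · refine ⟨[1, 0], fun k => ?_, ?_, ?_⟩
    · simp
      omega
    · simp [CascadeEdge]
    · simp [CascadeEdge]
  · rintro p r hp hr - ⟨l, hmem, hpw, hch⟩
    -- This undoes the contraction: a vertex k < p expands to the edge from k to its mirror image,
    -- and every other vertex is only relabelled.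
    refine ⟨l.flatMap fun k => if k < p then [k, p + (p + r) - 1 - k] else [p + (p + r) - 1 - k],
      fun k => ?_, ?_, ?_⟩
    · simp only [List.mem_flatMap, hmem]
      constructor
      · rintro ⟨a, ha, h⟩
        split_ifs at h <;> simp at h <;> omega
      · intro h
        by_cases hk : k < p
        · exact ⟨k, by omega, by simp [hk]⟩
        · refine ⟨p + (p + r) - 1 - k, by omega, ?_⟩
          have : k = p + (p + r) - 1 - (p + (p + r) - 1 - k) := by omega
          split_ifs <;> simp [← this]
    · rw [List.pairwise_flatMap]
      constructor
      · intro a ha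
        have ha' := (hmem a).1 ha
        split_ifs with h
        · simp only [List.pairwise_cons, List.mem_singleton, forall_eq, List.not_mem_nil,
            false_imp_iff, implies_true, List.Pairwise.nil, and_true]
          exact ⟨by omega, not_cascadeEdge_lower (by omega) h⟩
        · simp
      · refine hpw.imp_of_mem ?_
        intro a b ha hb ⟨hab, hE⟩ x hx y hy
        have ha' := (hmem a).1 ha
        have hb' := (hmem b).1 hb
        rw [cascadeEdge_step hr hb' ha'] at hE
        have hx' : (x = a ∧ a < p) ∨ x = p + (p + r) - 1 - a := by
          split_ifs at hx <;> simp at hx <;> tauto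
        have hy' : (y = b ∧ b < p) ∨ y = p + (p + r) - 1 - b := by
          split_ifs at hy <;> simp at hy <;> tauto
        rcases hx' with ⟨rfl, h1⟩ | rfl <;> rcases hy' with ⟨rfl, h2⟩ | rfl
        · tauto
        · exact ⟨by omega, not_cascadeEdge_lower (by omega) h1⟩
        -- The only edge from b into the second block ends at the mirror image of b, and a ≠ b.
        · refine ⟨by omega, ?_⟩
          rw [cascadeEdge_upper hr h2 (by omega)]
          omega
        · refine ⟨by omega, ?_⟩
          tauto
    · rw [List.flatMap, List.isChain_flatten]
      · constructor
        · intro m hm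
          obtain ⟨a, ha, rfl⟩ := List.mem_map.1 hm
          have ha' := (hmem a).1 ha
          split_ifs with h
          · simp only [List.isChain_cons_cons, List.isChain_singleton, and_true]
            left
            rw [cascadeEdge_upper hr h (by omega)]
            omega
          · simp
        · rw [List.isChain_map]
          have hch' : l.IsChain (fun a b => a < p + r ∧ b < p + r ∧
              (CascadeEdge p r a b ∨ (b < p ∧ p ≤ a))) := by
            refine List.isChain_iff_getElem.2 fun i hi => ?_
            exact ⟨(hmem _).1 (List.getElem_mem _), (hmem _).1 (List.getElem_mem _),
              List.isChain_iff_getElem.1 hch i hi⟩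
          refine hch'.imp ?_
          rintro a b ⟨ha, hb, hab⟩ x hx y hy
          rw [cascadeEdge_step hr ha hb] at hab
          have hx' : x = p + (p + r) - 1 - a := by
            split_ifs at hx <;> simp at hx <;> omega
          subst hx'
          -- Each piece ends at an index at least p, so a step into a piece starting with b < p is a
          -- lower left position. Otherwise the step must come from an edge of the second block.
          split_ifs at hy with h
          · simp at hy
            right
            omega
          · simp at hy
            subst hy
            left
            rcases hab with (hab | hab) | hab
            · exact hab
            · omega
            · omega
      · intro h
        obtain ⟨a, ha, h⟩ := List.mem_map.1 h
        split_ifs at h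
  · rintro p q hp hq ⟨l, hmem, hpw, hch⟩
    -- The reflection carries an edge from a to b to an edge from the image of b to the image of a,
    -- so the order has to be reversed.
    refine ⟨(l.map fun k => p + q - 1 - k).reverse, fun k => ?_, ?_, ?_⟩
    · simp only [List.mem_reverse, List.mem_map, hmem]
      constructor
      · rintro ⟨a, ha, rfl⟩
        omega
      · intro h
        exact ⟨p + q - 1 - k, by omega, by omega⟩
    · rw [List.pairwise_reverse, List.pairwise_map]
      refine hpw.imp_of_mem ?_
      intro a b ha hb ⟨hab, hE⟩
      have ha' := (hmem a).1 ha
      have hb' := (hmem b).1 hb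
      exact ⟨by omega, by rwa [cascadeEdge_swap hb' ha']⟩
    · rw [List.isChain_reverse, List.isChain_map]
      have hch' : l.IsChain (fun a b => a < p + q ∧ b < p + q ∧
          (CascadeEdge p q a b ∨ (b < p ∧ p ≤ a))) := by
        refine List.isChain_iff_getElem.2 fun i hi => ?_
        exact ⟨(hmem _).1 (List.getElem_mem _), (hmem _).1 (List.getElem_mem _),
          List.isChain_iff_getElem.1 hch i hi⟩
      refine hch'.imp ?_
      rintro a b ⟨ha, hb, hab⟩
      rw [cascadeEdge_swap ha hb]
      exact hab.imp_right fun h => by omega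

variable {K : Type*} [Field K]

/-- A function lowered by one along every edge and with prescribed sums over the two blocks. -/
theorem exists_grading {p q : ℕ} (hp : 0 < p) (hq : 0 < q) (hco : Nat.Coprime p q) (s t : K) :
    ∃ h : ℕ → K, (∀ i j, CascadeEdge p q i j → h i - h j = -1) ∧
      ∑ i ∈ Finset.range p, h i = s ∧ ∑ i ∈ Finset.range q, h (p + i) = t := by
  refine coprime_induction (P := fun p q => ∀ s t : K, ∃ h : ℕ → K,
      (∀ i j, CascadeEdge p q i j → h i - h j = -1) ∧
      ∑ i ∈ Finset.range p, h i = s ∧ ∑ i ∈ Finset.range q, h (p + i) = t) ?_ ?_ ?_ hp hq hco s t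
  · intro s t
    refine ⟨fun i => if i = 0 then s else t, ?_, by simp, by simp⟩
    intro i j h
    unfold CascadeEdge at h
    omega
  · intro p r hp hr _ ih s t
    -- On the first block the new function is h - 1, which makes the contracted edges drop by one;
    -- on the second it is h read backwards, whose sum is the total of h. The two arguments solve
    -- for these sums. The reduction alters the sums, so arbitrary ones have to be carried along.
    obtain ⟨h, hE, hs, ht⟩ := ih (s + p) (t - s - p)
    refine ⟨fun k => if k < p then h k - 1 else h (p + (p + r) - 1 - k), ?_, ?_, ?_⟩
    · intro i j hij
      obtain ⟨hi, hj⟩ := hij.lt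
      by_cases h1 : i < p <;> by_cases h2 : j < p <;> simp only [h1, h2, if_true, if_false]
      · have := hE i j ((cascadeEdge_step hr (by omega) (by omega)).2 (Or.inr ⟨h1, h2, hij⟩))
        linear_combination this
      · have h3 := (cascadeEdge_upper hr h1 (by omega)).1 hij
        have : p + (p + r) - 1 - j = i := by omega
        rw [this]
        ring
      · exact absurd hij (not_cascadeEdge_lower (by omega) h2)
      · apply hE
        rw [cascadeEdge_step hr (by omega) (by omega)]
        left
        convert hij using 1 <;> omega
    · rw [Finset.sum_congr rfl (g := fun k => h k - 1) fun i hi => by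
        simp [Finset.mem_range.1 hi]]
      simp [hs]
    · rw [Finset.sum_congr rfl (g := fun k => h (p + r - 1 - k)) fun i hi => by
        have := Finset.mem_range.1 hi
        simp only [show ¬ p + i < p by omega, if_false]
        congr 1
        omega, Finset.sum_range_reflect, Finset.sum_range_add, hs, ht]
      ring
  · intro p q hp hq ih s t
    obtain ⟨h, hE, hs, ht⟩ := ih (-t) (-s)
    refine ⟨fun k => - h (p + q - 1 - k), ?_, ?_, ?_⟩
    · intro i j hij
      obtain ⟨hi, hj⟩ := hij.lt
      have := hE (p + q - 1 - j) (p + q - 1 - i)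
        (by rw [add_comm p q]; exact (cascadeEdge_swap hi hj).2 hij)
      linear_combination this
    · rw [Finset.sum_neg_distrib, show s = -(-s) by ring, ← ht,
        ← Finset.sum_range_reflect (fun k => h (p + k)) q]
      congr 1
      refine Finset.sum_congr rfl fun i hi => ?_
      have := Finset.mem_range.1 hi
      congr 1
      omega
    · rw [Finset.sum_neg_distrib, show t = -(-t) by ring, ← hs,
        ← Finset.sum_range_reflect h p]
      congr 1
      refine Finset.sum_congr rfl fun i hi => ?_
      have := Finset.mem_range.1 hi
      congr 1
      omega

/-- A function constant along the edges and with vanishing sums over the two blocks is zero. -/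
theorem grading_unique {p q : ℕ} (hp : 0 < p) (hq : 0 < q) (hco : Nat.Coprime p q) (h : ℕ → K)
    (hE : ∀ i j, CascadeEdge p q i j → h i = h j)
    (hs : ∑ i ∈ Finset.range p, h i = 0) (ht : ∑ i ∈ Finset.range q, h (p + i) = 0) :
    ∀ i < p + q, h i = 0 := by
  refine coprime_induction (P := fun p q => ∀ h : ℕ → K,
      (∀ i j, CascadeEdge p q i j → h i = h j) →
      ∑ i ∈ Finset.range p, h i = 0 → ∑ i ∈ Finset.range q, h (p + i) = 0 →
      ∀ i < p + q, h i = 0) ?_ ?_ ?_ hp hq hco h hE hs ht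
  · intro h _ hs ht i hi
    simp at hs ht
    interval_cases i <;> assumption
  · intro p r hp hr _ ih h hE hs ht
    -- The contracted edges make h agree on the first block and on its mirror image, so h is
    -- determined by its values on the second block.
    have hh : ∀ i < p, h (p + (p + r) - 1 - i) = h i := fun i hi =>
      (hE _ _ ((cascadeEdge_upper hr hi (by omega)).2 (by omega))).symm
    have hs' : ∑ i ∈ Finset.range p, h (p + (p + r) - 1 - i) = 0 := by
      rw [← hs]
      exact Finset.sum_congr rfl fun i hi => hh i (Finset.mem_range.1 hi)
    have key := ih (fun k => h (p + (p + r) - 1 - k)) ?_ hs' ?_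
    · intro i hi
      by_cases h1 : i < p
      · rw [← hh i h1]
        exact key i (by omega)
      · have := key (p + (p + r) - 1 - i) (by omega)
        beta_reduce at this
        rwa [show p + (p + r) - 1 - (p + (p + r) - 1 - i) = i by omega] at this
    · intro i j hij
      obtain ⟨hi, hj⟩ := hij.lt
      rcases (cascadeEdge_step hr hi hj).1 hij with h1 | ⟨h1, h2, h3⟩
      · exact hE _ _ h1
      · simp only [hh i h1, hh j h2, hE _ _ h3]
    · have h1 : ∑ k ∈ Finset.range (p + r), h (p + (p + r) - 1 - k) = 0 := by
        rw [← ht, ← Finset.sum_range_reflect (fun k => h (p + k))]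
        refine Finset.sum_congr rfl fun i hi => ?_
        have := Finset.mem_range.1 hi
        congr 1
        omega
      rwa [Finset.sum_range_add, hs', zero_add] at h1
  · intro p q hp hq ih h hE hs ht
    have key := ih (fun k => h (p + q - 1 - k)) ?_ ?_ ?_
    · intro i hi
      have := key (p + q - 1 - i) (by omega)
      beta_reduce at this
      rwa [show p + q - 1 - (p + q - 1 - i) = i by omega] at this
    · intro i j hij
      obtain ⟨hi, hj⟩ := hij.lt
      exact (hE _ _ ((cascadeEdge_swap hi hj).2 hij)).symm
    · rw [← ht, ← Finset.sum_range_reflect (fun k => h (q + k)) p]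
      refine Finset.sum_congr rfl fun i hi => ?_
      have := Finset.mem_range.1 hi
      congr 1
      omega
    · rw [← hs, ← Finset.sum_range_reflect h q]
      refine Finset.sum_congr rfl fun i hi => ?_
      have := Finset.mem_range.1 hi
      congr 1
      omega

end IndexOne

/-! ### Points of the dual of the truncated parabolic as block triples -/

namespace IndexOne

open Matrix

/-- The blocks of a matrix `[A, B; *, D]` modulo its lower left block. -/
@[ext]
structure Triple (K W U : Type*) where
  A : Matrix W W K
  B : Matrix W U K
  D : Matrix U U K

namespace Triple

variable {K : Type*} [Field K]

section Defs

variable {W U W₂ U₂ : Type} [Fintype W] [DecidableEq W] [Fintype U] [DecidableEq U]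
  [Fintype W₂] [DecidableEq W₂] [Fintype U₂] [DecidableEq U₂]

/-- Bracketing with `[a, 0; c, d]` multiplies `y` by `ε`, modulo the lower left block and
scalars in the two diagonal blocks. -/
structure IsDer (y : Triple K W U) (ε : K) (a : Matrix W W K) (c : Matrix U W K)
    (d : Matrix U U K) (μ ν : K) : Prop where
  hA : a * y.A - y.A * a - y.B * c = ε • y.A + μ • (1 : Matrix W W K)
  hB : a * y.B - y.B * d = ε • y.B
  hD : c * y.B + d * y.D - y.D * d = ε • y.D + ν • (1 : Matrix U U K)

/-- The ambient space for the stabilizer of a triple. -/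
abbrev Ambient (K W U : Type*) := Matrix W W K × Matrix U W K × Matrix U U K × K × K

/-- The stabilizer of a triple in the truncated parabolic. -/
def stab (y : Triple K W U) : Submodule K (Ambient K W U) where
  carrier := {t | y.IsDer 0 t.1 t.2.1 t.2.2.1 t.2.2.2.1 t.2.2.2.2 ∧
    t.1.trace = 0 ∧ t.2.2.1.trace = 0}
  zero_mem' := by
    refine ⟨⟨?_, ?_, ?_⟩, ?_, ?_⟩ <;> simp
  add_mem' := by
    rintro s t ⟨⟨a, b, c⟩, d, e⟩ ⟨⟨a', b', c'⟩, d', e'⟩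
    refine ⟨⟨?_, ?_, ?_⟩, ?_, ?_⟩
    · simp only [Prod.fst_add, Prod.snd_add, add_mul, mul_add, Matrix.mul_add, add_smul]
      have := congrArg₂ (· + ·) a a'
      simp only [zero_smul, zero_add] at this ⊢
      rw [← this]
      abel
    · simp only [Prod.fst_add, Prod.snd_add, Matrix.add_mul, Matrix.mul_add]
      have := congrArg₂ (· + ·) b b'
      simp only [zero_smul, add_zero] at this ⊢
      rw [← this]
      abel
    · simp only [Prod.fst_add, Prod.snd_add, add_mul, mul_add, Matrix.add_mul, add_smul]
      have := congrArg₂ (· + ·) c c'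
      simp only [zero_smul, zero_add] at this ⊢
      rw [← this]
      abel
    · simp [d, d']
    · simp [e, e']
  smul_mem' := by
    rintro r t ⟨⟨a, b, c⟩, d, e⟩
    refine ⟨⟨?_, ?_, ?_⟩, ?_, ?_⟩
    · have := congrArg (r • ·) a
      simpa [smul_sub, smul_smul] using this
    · have := congrArg (r • ·) b
      simpa [smul_sub, smul_smul] using this
    · have := congrArg (r • ·) c
      simpa [smul_sub, smul_smul] using this
    · simp [d]
    · simp [e]

/-- An element scaling the triple by `-1` whose traces satisfy an integrality condition stable
under the Euclidean reduction. -/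
def IsAdapted (y : Triple K W U) : Prop :=
  ∃ a c d μ ν, y.IsDer (-1) a c d μ ν ∧
    ∃ N : ℕ, (Fintype.card U : K) * a.trace - (Fintype.card W : K) * d.trace = N

/-- Conjugation by an invertible block lower triangular matrix. -/
structure Iso (y : Triple K W U) (y₂ : Triple K W₂ U₂) where
  g : Matrix W₂ W K
  g' : Matrix W W₂ K
  k : Matrix U₂ U K
  k' : Matrix U U₂ K
  f : Matrix U₂ W₂ K
  μ : K
  ν : K
  gg' : g * g' = 1
  g'g : g' * g = 1
  kk' : k * k' = 1
  k'k : k' * k = 1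
  hA : y₂.A = g * (y.A * g') - g * (y.B * (k' * f)) - μ • (1 : Matrix W₂ W₂ K)
  hB : y₂.B = g * (y.B * k')
  hD : y₂.D = k * (y.D * k') + f * (g * (y.B * k')) - ν • (1 : Matrix U₂ U₂ K)

/-- The triple attached to the antitransposed matrix. -/
def dual (y : Triple K W U) : Triple K U W := ⟨y.Dᵀ, y.Bᵀ, y.Aᵀ⟩

/-- The triple with first diagonal block zero and surjective off-diagonal block which reduces
to `y`. -/
def std (y : Triple K W U) (C : Matrix U W K) : Triple K W (W ⊕ U) :=
  ⟨0, fromCols 1 0, fromBlocks y.A y.B C y.D⟩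

end Defs

section Iso

variable {W U W₂ U₂ W₃ U₃ : Type} [Fintype W] [DecidableEq W] [Fintype U] [DecidableEq U]
  [Fintype W₂] [DecidableEq W₂] [Fintype U₂] [DecidableEq U₂]
  [Fintype W₃] [DecidableEq W₃] [Fintype U₃] [DecidableEq U₃]
  {y : Triple K W U} {y₂ : Triple K W₂ U₂} {y₃ : Triple K W₃ U₃}

theorem cancel_left {X Y Z : Type} [Fintype X] [Fintype Y] [DecidableEq X]
    {a : Matrix X Y K} {b : Matrix Y X K} (h : a * b = 1) (c : Matrix X Z K) :
    a * (b * c) = c := by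
  rw [← Matrix.mul_assoc, h, Matrix.one_mul]

/-- Isomorphisms of triples can be inverted. -/
def Iso.symm (φ : Iso y y₂) : Iso y₂ y where
  g := φ.g'
  g' := φ.g
  k := φ.k'
  k' := φ.k
  f := - (φ.k' * (φ.f * φ.g))
  μ := -φ.μ
  ν := -φ.ν
  gg' := φ.g'g
  g'g := φ.gg'
  kk' := φ.k'k
  k'k := φ.kk'
  hA := by
    simp [φ.hA, φ.hB, Matrix.sub_mul, Matrix.mul_sub, Matrix.mul_assoc, cancel_left φ.g'g,
      cancel_left φ.kk', φ.g'g]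
    abel
  hB := by
    simp [φ.hB, Matrix.mul_assoc, cancel_left φ.g'g, φ.k'k]
  hD := by
    simp [φ.hD, φ.hB, Matrix.sub_mul, Matrix.mul_sub, Matrix.add_mul, Matrix.mul_add,
      Matrix.mul_assoc, cancel_left φ.gg', cancel_left φ.k'k, φ.k'k]
    abel

/-- Isomorphisms of triples can be composed. -/
def Iso.trans (φ : Iso y y₂) (ψ : Iso y₂ y₃) : Iso y y₃ where
  g := ψ.g * φ.g
  g' := φ.g' * ψ.g'
  k := ψ.k * φ.k
  k' := φ.k' * ψ.k'
  f := ψ.f + ψ.k * (φ.f * ψ.g')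
  μ := ψ.μ + φ.μ
  ν := ψ.ν + φ.ν
  gg' := by simp [Matrix.mul_assoc, cancel_left φ.gg', ψ.gg']
  g'g := by simp [Matrix.mul_assoc, cancel_left ψ.g'g, φ.g'g]
  kk' := by simp [Matrix.mul_assoc, cancel_left φ.kk', ψ.kk']
  k'k := by simp [Matrix.mul_assoc, cancel_left ψ.k'k, φ.k'k]
  hA := by
    simp only [ψ.hA, φ.hA, φ.hB, Matrix.sub_mul, Matrix.mul_sub, Matrix.mul_add,
      Matrix.mul_assoc, cancel_left ψ.k'k, Matrix.smul_mul, Matrix.mul_smul, ψ.gg',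
      Matrix.one_mul, add_smul]
    abel
  hB := by simp [ψ.hB, φ.hB, Matrix.mul_assoc]
  hD := by
    simp only [ψ.hD, φ.hD, φ.hB, Matrix.sub_mul, Matrix.mul_sub, Matrix.mul_add, Matrix.add_mul,
      Matrix.mul_assoc, cancel_left ψ.g'g, Matrix.smul_mul, Matrix.mul_smul, ψ.kk',
      Matrix.one_mul, add_smul]
    abel

/-- Isomorphisms of triples can be antitransposed. -/
def Iso.dual (φ : Iso y y₂) : Iso y.dual y₂.dual where
  g := φ.k'ᵀ
  g' := φ.kᵀ
  k := φ.g'ᵀ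
  k' := φ.gᵀ
  f := -φ.fᵀ
  μ := φ.ν
  ν := φ.μ
  gg' := by rw [← transpose_mul, φ.kk', transpose_one]
  g'g := by rw [← transpose_mul, φ.k'k, transpose_one]
  kk' := by rw [← transpose_mul, φ.gg', transpose_one]
  k'k := by rw [← transpose_mul, φ.g'g, transpose_one]
  hA := by simp [Triple.dual, φ.hD, Matrix.mul_assoc]
  hB := by simp [Triple.dual, φ.hB, Matrix.mul_assoc]
  hD := by
    simp [Triple.dual, φ.hA, Matrix.mul_assoc]
    abel

/-- The scalars by which y₂ differs from the conjugated triple are invisible to brackets but are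
multiplied by ε, whence the correction terms. The check moves a and d to the left of A, B and D by
means of the given equations. -/
theorem IsDer.conj {ε : K} {a : Matrix W W K} {c : Matrix U W K} {d : Matrix U U K} {μ ν : K}
    (h : y.IsDer ε a c d μ ν) (φ : Iso y y₂) :
    y₂.IsDer ε (φ.g * (a * φ.g'))
      (φ.f * (φ.g * (a * φ.g')) + φ.k * (c * φ.g') - φ.k * (d * (φ.k' * φ.f)))
      (φ.k * (d * φ.k')) (μ + ε * φ.μ) (ν + ε * φ.ν) := by
  have hA : y.A * a = a * y.A - y.B * c - ε • y.A - μ • (1 : Matrix W W K) := by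
    rw [sub_sub, ← h.hA]
    abel
  have hB : y.B * d = a * y.B - ε • y.B := by
    rw [← h.hB]
    abel
  have hD : y.D * d = c * y.B + d * y.D - ε • y.D - ν • (1 : Matrix U U K) := by
    rw [sub_sub, ← h.hD]
    abel
  have hA' : ∀ {Z : Type} (X : Matrix W Z K), y.A * (a * X) =
      a * (y.A * X) - y.B * (c * X) - ε • (y.A * X) - μ • X := by
    intro Z X
    rw [← Matrix.mul_assoc, hA]
    simp [Matrix.sub_mul, Matrix.mul_assoc]
  have hB' : ∀ {Z : Type} (X : Matrix U Z K), y.B * (d * X) =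
      a * (y.B * X) - ε • (y.B * X) := by
    intro Z X
    rw [← Matrix.mul_assoc, hB]
    simp [Matrix.sub_mul, Matrix.mul_assoc]
  have hD' : ∀ {Z : Type} (X : Matrix U Z K), y.D * (d * X) =
      c * (y.B * X) + d * (y.D * X) - ε • (y.D * X) - ν • X := by
    intro Z X
    rw [← Matrix.mul_assoc, hD]
    simp [Matrix.sub_mul, Matrix.add_mul, Matrix.mul_assoc]
  refine ⟨?_, ?_, ?_⟩
  · simp only [φ.hA, φ.hB, Matrix.sub_mul, Matrix.mul_sub, Matrix.mul_add,
      Matrix.mul_assoc, cancel_left φ.g'g, cancel_left φ.k'k, hA', hB', Matrix.smul_mul,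
      Matrix.mul_smul, φ.gg', Matrix.mul_one, Matrix.one_mul, add_smul, smul_sub, mul_smul]
    abel
  · simp only [φ.hB, Matrix.mul_sub, Matrix.mul_assoc, cancel_left φ.g'g, cancel_left φ.k'k, hB',
      Matrix.mul_smul]
    abel
  · simp only [φ.hD, φ.hB, Matrix.sub_mul, Matrix.mul_sub, Matrix.mul_add, Matrix.add_mul,
      Matrix.mul_assoc, cancel_left φ.g'g, cancel_left φ.k'k, hD', hB', Matrix.smul_mul,
      Matrix.mul_smul, φ.kk', Matrix.mul_one, Matrix.one_mul, add_smul, smul_sub, smul_add,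
      mul_smul]
    abel

/-- Transposition reverses brackets, whence the signs; the diagonal blocks and their scalars change
places. -/
theorem IsDer.dual {ε : K} {a : Matrix W W K} {c : Matrix U W K} {d : Matrix U U K} {μ ν : K}
    (h : y.IsDer ε a c d μ ν) : y.dual.IsDer ε (-dᵀ) (-cᵀ) (-aᵀ) ν μ := by
  refine ⟨?_, ?_, ?_⟩
  · have := congrArg transpose h.hD
    simp [transpose_mul] at this
    simp [Triple.dual, ← this]
    abel
  · have := congrArg transpose h.hB
    simp [transpose_mul] at this
    simp [Triple.dual, ← this]
    abel
  · have := congrArg transpose h.hA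
    simp [transpose_mul] at this
    simp [Triple.dual, ← this]
    abel

theorem trace_conj {X Y : Type} [Fintype X] [Fintype Y] [DecidableEq Y]
    {g : Matrix X Y K} {g' : Matrix Y X K} (h : g' * g = 1) (a : Matrix Y Y K) :
    (g * (a * g')).trace = a.trace := by
  rw [Matrix.trace_mul_comm, Matrix.mul_assoc, h, Matrix.mul_one]

theorem Iso.finrank_le (φ : Iso y y₂) :
    Module.finrank K y.stab ≤ Module.finrank K y₂.stab := by
  let F : Ambient K W U →ₗ[K] Ambient K W₂ U₂ :=
    { toFun := fun t => (φ.g * (t.1 * φ.g'),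
        φ.f * (φ.g * (t.1 * φ.g')) + φ.k * (t.2.1 * φ.g') - φ.k * (t.2.2.1 * (φ.k' * φ.f)),
        φ.k * (t.2.2.1 * φ.k'), t.2.2.2)
      map_add' := by
        intro s t
        ext1
        · simp [Matrix.add_mul, Matrix.mul_add]
        ext1
        · simp [Matrix.add_mul, Matrix.mul_add]
          abel
        · simp [Matrix.add_mul, Matrix.mul_add]
      map_smul' := by
        intro s t
        simp [smul_sub] }
  have hF : ∀ t ∈ y.stab, F t ∈ y₂.stab := by
    rintro t ⟨h, h1, h2⟩
    refine ⟨?_, ?_, ?_⟩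
    · have := h.conj φ
      simp only [zero_mul, add_zero] at this
      exact this
    · exact (trace_conj φ.g'g _).trans h1
    · exact (trace_conj φ.k'k _).trans h2
  refine LinearMap.finrank_le_finrank_of_injective (f := F.restrict hF) ?_
  have inj : Function.Injective F := by
    rw [← LinearMap.ker_eq_bot, LinearMap.ker_eq_bot']
    rintro ⟨a, c, d, m⟩ h
    simp only [F, LinearMap.coe_mk, AddHom.coe_mk, Prod.mk_eq_zero] at h
    obtain ⟨h1, h2, h3, h4⟩ := h
    have ha : a = 0 := by
      have := congrArg (fun z => φ.g' * (z * φ.g)) h1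
      simpa [Matrix.mul_assoc, cancel_left φ.g'g, φ.g'g] using this
    have hd : d = 0 := by
      have := congrArg (fun z => φ.k' * (z * φ.k)) h3
      simpa [Matrix.mul_assoc, cancel_left φ.k'k, φ.k'k] using this
    subst ha hd
    have hc : c = 0 := by
      have := congrArg (fun z => φ.k' * (z * φ.g)) h2
      simpa [Matrix.mul_assoc, cancel_left φ.k'k, φ.g'g] using this
    simp [hc, h4]
  intro s t h
  exact Subtype.ext (inj (congrArg Subtype.val h))

theorem Iso.finrank_eq (φ : Iso y y₂) :
    Module.finrank K y.stab = Module.finrank K y₂.stab :=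
  le_antisymm φ.finrank_le φ.symm.finrank_le

theorem finrank_dual_le (y : Triple K W U) :
    Module.finrank K y.stab ≤ Module.finrank K y.dual.stab := by
  let F : Ambient K W U →ₗ[K] Ambient K U W :=
    { toFun := fun t => (-t.2.2.1ᵀ, -t.2.1ᵀ, -t.1ᵀ, t.2.2.2.2, t.2.2.2.1)
      map_add' := by
        intro s t
        simp
        refine ⟨?_, ?_, ?_⟩ <;> abel
      map_smul' := by
        intro s t
        simp }
  have hF : ∀ t ∈ y.stab, F t ∈ y.dual.stab := by
    rintro t ⟨h, h1, h2⟩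
    refine ⟨h.dual, ?_, ?_⟩
    · change (-t.2.2.1ᵀ).trace = 0
      simpa using h2
    · change (-t.1ᵀ).trace = 0
      simpa using h1
  refine LinearMap.finrank_le_finrank_of_injective (f := F.restrict hF) ?_
  rintro ⟨⟨a, c, d, m, n⟩, hs⟩ ⟨⟨a', c', d', m', n'⟩, ht⟩ h
  have : ((-dᵀ, -cᵀ, -aᵀ, n, m) : Ambient K U W) = (-d'ᵀ, -c'ᵀ, -a'ᵀ, n', m') :=
    congrArg Subtype.val h
  simp only [Prod.mk.injEq, neg_inj, transpose_inj] at this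
  simp [this]

theorem finrank_dual (y : Triple K W U) :
    Module.finrank K y.dual.stab = Module.finrank K y.stab :=
  le_antisymm (finrank_dual_le y.dual) (finrank_dual_le y)

theorem IsAdapted.iso (h : y.IsAdapted) (φ : Iso y y₂)
    (hW : Fintype.card W = Fintype.card W₂) (hU : Fintype.card U = Fintype.card U₂) :
    y₂.IsAdapted := by
  obtain ⟨a, c, d, μ, ν, h, N, hN⟩ := h
  refine ⟨_, _, _, _, _, h.conj φ, N, ?_⟩
  rw [trace_conj φ.g'g, trace_conj φ.k'k, ← hW, ← hU, hN]

theorem IsAdapted.dual (h : y.IsAdapted) : y.dual.IsAdapted := by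
  obtain ⟨a, c, d, μ, ν, h, N, hN⟩ := h
  refine ⟨_, _, _, _, _, h.dual, N, ?_⟩
  rw [← hN]
  simp
  ring

end Iso

end Triple

end IndexOne

/-! ### Reduction of a triple in normal form to a smaller triple -/

namespace IndexOne

open Matrix

namespace Triple

variable {K : Type*} [Field K]

variable {W U W₂ U₂ : Type} [Fintype W] [DecidableEq W] [Fintype U] [DecidableEq U]
  [Fintype W₂] [DecidableEq W₂] [Fintype U₂] [DecidableEq U₂]

theorem fromBlocks_sub {X Y X' Y' : Type} (a a' : Matrix X Y K) (b b' : Matrix X Y' K)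
    (c c' : Matrix X' Y K) (d d' : Matrix X' Y' K) :
    fromBlocks a b c d - fromBlocks a' b' c' d' =
      fromBlocks (a - a') (b - b') (c - c') (d - d') := by
  ext (i | i) (j | j) <;> rfl

theorem trace_fromBlocks {X Y : Type} [Fintype X] [Fintype Y] (a : Matrix X X K)
    (b : Matrix X Y K) (c : Matrix Y X K) (d : Matrix Y Y K) :
    (fromBlocks a b c d).trace = a.trace + d.trace := by
  simp [Matrix.trace, Fintype.sum_sum_type]

theorem fromCols_ext_iff {X W U K : Type*} {a a' : Matrix X W K} {b b' : Matrix X U K} :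
    fromCols a b = fromCols a' b' ↔ a = a' ∧ b = b' :=
  ⟨fun h => ⟨by simpa using congrArg toCols₁ h, by simpa using congrArg toCols₂ h⟩,
    fun h => by rw [h.1, h.2]⟩

/-- With A = 0 and B = (1 0), the first two equations solve for c₁, a and d₁₂, and the lower left
part of the third solves for c₂. The remaining parts are the equations of the reduced triple; C
enters only the formula for c₂. The shift by ε in a is what changes the traces. -/
theorem isDer_std_iff (y : Triple K W U) (C : Matrix U W K) (ε : K) (a c₁ d₁₁ : Matrix W W K)
    (c₂ : Matrix U W K) (d₁₂ : Matrix W U K) (d₂₁ : Matrix U W K) (d₂₂ : Matrix U U K) (μ ν : K) :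
    (y.std C).IsDer ε a (fromRows c₁ c₂) (fromBlocks d₁₁ d₁₂ d₂₁ d₂₂) μ ν ↔
      a = d₁₁ + ε • 1 ∧ d₁₂ = 0 ∧ c₁ = -μ • (1 : Matrix W W K) ∧
      c₂ = ε • C - (d₂₁ * y.A + d₂₂ * C - C * d₁₁ - y.D * d₂₁) ∧
      y.IsDer ε d₁₁ d₂₁ d₂₂ (μ + ν) ν := by
  have key : (y.std C).IsDer ε a (fromRows c₁ c₂) (fromBlocks d₁₁ d₁₂ d₂₁ d₂₂) μ ν ↔
      (-c₁ = μ • (1 : Matrix W W K)) ∧ (a - d₁₁ = ε • (1 : Matrix W W K) ∧ -d₁₂ = 0) ∧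
      (c₁ + (d₁₁ * y.A + d₁₂ * C) - (y.A * d₁₁ + y.B * d₂₁) = ε • y.A + ν • 1 ∧
        (d₁₁ * y.B + d₁₂ * y.D) - (y.A * d₁₂ + y.B * d₂₂) = ε • y.B ∧
        c₂ + (d₂₁ * y.A + d₂₂ * C) - (C * d₁₁ + y.D * d₂₁) = ε • C ∧
        (d₂₁ * y.B + d₂₂ * y.D) - (C * d₁₂ + y.D * d₂₂) = ε • y.D + ν • 1) := by
    have e1 : fromRows c₁ c₂ * fromCols (1 : Matrix W W K) (0 : Matrix W U K) =
        fromBlocks c₁ 0 c₂ 0 := by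
      rw [fromRows_mul_fromCols]
      simp
    have e2 : fromCols (1 : Matrix W W K) (0 : Matrix W U K) * fromRows c₁ c₂ = c₁ := by
      rw [fromCols_mul_fromRows]
      simp
    have e3 : fromCols (1 : Matrix W W K) (0 : Matrix W U K) * fromBlocks d₁₁ d₁₂ d₂₁ d₂₂ =
        fromCols d₁₁ d₁₂ := by
      rw [fromCols_mul_fromBlocks]
      simp
    have e4 : a * fromCols (1 : Matrix W W K) (0 : Matrix W U K) = fromCols a 0 := by
      rw [mul_fromCols]
      simp
    have e5 : fromCols a (0 : Matrix W U K) - fromCols d₁₁ d₁₂ = fromCols (a - d₁₁) (-d₁₂) := by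
      ext i (j | j) <;> simp
    have e6 : ε • fromCols (1 : Matrix W W K) (0 : Matrix W U K) = fromCols (ε • 1) 0 := by
      ext i (j | j) <;> simp
    constructor
    · rintro ⟨h1, h2, h3⟩
      simp only [std, e1, e2, e3, e4, e5, e6, fromBlocks_multiply, fromBlocks_add, fromBlocks_smul,
        fromBlocks_sub, ← fromBlocks_one, fromBlocks_inj, fromCols_ext_iff] at h1 h2 h3
      simpa using And.intro h1 (And.intro h2 h3)
    · rintro ⟨h1, h2, h3⟩
      refine ⟨?_, ?_, ?_⟩
      · simpa [std, e2] using h1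
      · simp only [std, e3, e4, e5, e6, fromCols_ext_iff]
        exact h2
      · simp only [std, e1, fromBlocks_multiply, fromBlocks_add, fromBlocks_smul,
          fromBlocks_sub, ← fromBlocks_one, fromBlocks_inj]
        simpa using h3
  rw [key]
  constructor
  · rintro ⟨h1, ⟨h2, h3⟩, h4, h5, h6, h7⟩
    have h3' : d₁₂ = 0 := by simpa using h3
    have h1' : c₁ = -μ • (1 : Matrix W W K) := by
      rw [neg_smul, ← h1, neg_neg]
    subst h3'
    refine ⟨by rw [← h2]; abel, rfl, h1', ?_, ⟨?_, ?_, ?_⟩⟩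
    · rw [← h6]
      abel
    · rw [h1'] at h4
      rw [add_smul, add_left_comm, ← h4]
      simp
      abel
    · rw [← h5]
      simp
    · rw [← h7]
      simp
  · rintro ⟨rfl, rfl, rfl, rfl, h1, h2, h3⟩
    refine ⟨by simp, ⟨by simp, by simp⟩, ?_, ?_, ?_, ?_⟩
    · rw [add_smul, add_left_comm] at h1
      rw [← sub_eq_zero] at h1 ⊢
      rw [← h1]
      simp
      abel
    · rw [← h2]
      simp
    · abel
    · rw [← h3]
      simp

theorem finrank_std_le (y : Triple K W U) (C : Matrix U W K) :
    Module.finrank K (y.std C).stab ≤ Module.finrank K y.stab := by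
  let F : Ambient K W (W ⊕ U) →ₗ[K] Ambient K W U :=
    { toFun := fun t => (t.2.2.1.toBlocks₁₁, t.2.2.1.toBlocks₂₁, t.2.2.1.toBlocks₂₂,
        t.2.2.2.1 + t.2.2.2.2, t.2.2.2.2)
      map_add' := by
        intro s t
        simp only [Prod.fst_add, Prod.snd_add, Prod.mk_add_mk, Prod.mk.injEq]
        exact ⟨rfl, rfl, rfl, by ring, trivial⟩
      map_smul' := by
        intro r t
        simp only [Prod.smul_fst, Prod.smul_snd, Prod.smul_mk, Prod.mk.injEq, RingHom.id_apply]
        exact ⟨rfl, rfl, rfl, by simp [mul_add], trivial⟩ }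
  have split : ∀ t ∈ (y.std C).stab, _ := fun t ht =>
    (isDer_std_iff y C 0 t.1 t.2.1.toRows₁ t.2.2.1.toBlocks₁₁ t.2.1.toRows₂ t.2.2.1.toBlocks₁₂
      t.2.2.1.toBlocks₂₁ t.2.2.1.toBlocks₂₂ t.2.2.2.1 t.2.2.2.2).1 (by
        rw [fromRows_toRows, fromBlocks_toBlocks]
        exact ht.1)
  have hF : ∀ t ∈ (y.std C).stab, F t ∈ y.stab := by
    intro t ht
    obtain ⟨h1, h2, h3, h4, h5⟩ := split t ht
    refine ⟨h5, ?_, ?_⟩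
    · have := ht.2.1
      rw [h1] at this
      simpa [F] using this
    · have h6 := ht.2.1
      have h7 := ht.2.2
      rw [h1] at h6
      rw [← fromBlocks_toBlocks t.2.2.1, trace_fromBlocks] at h7
      simp only [zero_smul, add_zero] at h6
      rw [h6, zero_add] at h7
      exact h7
  refine LinearMap.finrank_le_finrank_of_injective (f := F.restrict hF) ?_
  rw [← LinearMap.ker_eq_bot, LinearMap.ker_eq_bot']
  rintro ⟨t, ht⟩ h
  obtain ⟨h1, h2, h3, h4, h5⟩ := split t ht
  have h6 : ((t.2.2.1.toBlocks₁₁, t.2.2.1.toBlocks₂₁, t.2.2.1.toBlocks₂₂,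
        t.2.2.2.1 + t.2.2.2.2, t.2.2.2.2) : Ambient K W U) = 0 := congrArg Subtype.val h
  simp only [Prod.mk_eq_zero] at h6
  obtain ⟨k1, k2, k3, k4, k5⟩ := h6
  rw [k5, add_zero] at k4
  rw [k1] at h1 h4
  rw [k2, k3] at h4
  rw [k4] at h3
  obtain ⟨a, c, d, μ, ν⟩ := t
  apply Subtype.ext
  simp only at *
  rw [← fromRows_toRows c, ← fromBlocks_toBlocks d, h1, h2, h3, h4, k1, k2, k3, k4, k5]
  simp

theorem finrank_le_std (y : Triple K W U) (C : Matrix U W K) :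
    Module.finrank K y.stab ≤ Module.finrank K (y.std C).stab := by
  let F : Ambient K W U →ₗ[K] Ambient K W (W ⊕ U) :=
    { toFun := fun t => (t.1, fromRows (-(t.2.2.2.1 - t.2.2.2.2) • 1)
          (- (t.2.1 * y.A + t.2.2.1 * C - C * t.1 - y.D * t.2.1)),
        fromBlocks t.1 0 t.2.1 t.2.2.1, t.2.2.2.1 - t.2.2.2.2, t.2.2.2.2)
      map_add' := by
        intro s t
        simp only [Prod.fst_add, Prod.snd_add, Prod.mk_add_mk, Prod.mk.injEq, fromBlocks_add,
          add_zero, true_and]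
        refine ⟨?_, by ring, trivial⟩
        ext (i | i) j
        · simp
          ring
        · simp [Matrix.add_mul, Matrix.mul_add]
          ring
      map_smul' := by
        intro r t
        simp only [Prod.smul_fst, Prod.smul_snd, Prod.smul_mk, Prod.mk.injEq, RingHom.id_apply,
          fromBlocks_smul, smul_zero, true_and]
        refine ⟨?_, by simp [mul_sub], trivial⟩
        ext (i | i) j
        · simp
          ring
        · simp
          ring }
  have hF : ∀ t ∈ y.stab, F t ∈ (y.std C).stab := by
    intro t ht
    refine ⟨(isDer_std_iff y C 0 _ _ _ _ _ _ _ _ _).2 ⟨by simp [F], rfl, rfl, by simp, ?_⟩,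
      ht.2.1, ?_⟩
    · have := ht.1
      simpa [F] using this
    · have h1 := ht.2.1
      have h2 := ht.2.2
      change (fromBlocks t.1 0 t.2.1 t.2.2.1).trace = 0
      rw [trace_fromBlocks, h1, h2, add_zero]
  refine LinearMap.finrank_le_finrank_of_injective (f := F.restrict hF) ?_
  rw [← LinearMap.ker_eq_bot, LinearMap.ker_eq_bot']
  rintro ⟨t, ht⟩ h
  have h6 : F t = 0 := congrArg Subtype.val h
  simp only [F, LinearMap.coe_mk, AddHom.coe_mk, Prod.mk_eq_zero, ← fromBlocks_zero,
    fromBlocks_inj] at h6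
  obtain ⟨k1, -, ⟨-, -, k2, k3⟩, k4, k5⟩ := h6
  rw [k5, sub_zero] at k4
  obtain ⟨a, c, d, μ, ν⟩ := t
  apply Subtype.ext
  simp only at *
  rw [k1, k2, k3, k4, k5]
  rfl

theorem finrank_std (y : Triple K W U) (C : Matrix U W K) :
    Module.finrank K (y.std C).stab = Module.finrank K y.stab :=
  le_antisymm (finrank_std_le y C) (finrank_le_std y C)

/-- Substituting a = d₁₁ - 1 shows that the trace combination grows by |W| (|W| + |U|). It stays a
natural number, and its non-negativity is what matters at size (1, 1). -/
theorem IsAdapted.of_std {y : Triple K W U} {C : Matrix U W K} (h : (y.std C).IsAdapted) :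
    y.IsAdapted := by
  obtain ⟨a, c, d, μ, ν, h, N, hN⟩ := h
  rw [← fromRows_toRows c, ← fromBlocks_toBlocks d, isDer_std_iff] at h
  obtain ⟨h1, h2, h3, h4, h5⟩ := h
  refine ⟨_, _, _, _, _, h5, N + Fintype.card W * Fintype.card (W ⊕ U), ?_⟩
  rw [← fromBlocks_toBlocks d, trace_fromBlocks, h1] at hN
  simp only [trace_add, trace_smul, trace_one, Fintype.card_sum] at hN ⊢
  push_cast at hN ⊢
  rw [← hN]
  simp
  ring

/-- An isomorphism of triples lifts to the triples reducing to them. -/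
def Iso.std {y : Triple K W U} {y₂ : Triple K W₂ U₂} (φ : Iso y y₂) (C : Matrix U W K)
    (C₂ : Matrix U₂ W₂ K) : Iso (y.std C) (y₂.std C₂) where
  g := φ.g
  g' := φ.g'
  k := fromBlocks φ.g 0 (φ.f * φ.g) φ.k
  k' := fromBlocks φ.g' 0 (-(φ.k' * φ.f)) φ.k'
  -- The first rows offset the scalar μ - ν, keeping the first diagonal block zero. The last rows
  -- carry C to the prescribed C₂.
  f := fromRows (-(φ.μ - φ.ν) • 1)
    (C₂ - φ.f * (φ.g * (y.A * φ.g')) - φ.k * (C * φ.g')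
      + φ.f * (φ.g * (y.B * (φ.k' * φ.f))) + φ.k * (y.D * (φ.k' * φ.f)))
  μ := φ.μ - φ.ν
  ν := φ.ν
  gg' := φ.gg'
  g'g := φ.g'g
  kk' := by
    simp [fromBlocks_multiply, Matrix.mul_assoc, φ.gg', φ.kk', cancel_left φ.kk']
  k'k := by
    simp [fromBlocks_multiply, Matrix.mul_assoc, φ.g'g, φ.k'k]
  hA := by
    simp only [Triple.std]
    rw [← Matrix.mul_assoc (fromCols 1 0), fromCols_mul_fromBlocks, fromCols_mul_fromRows]
    simp only [Matrix.mul_zero, Matrix.zero_mul, Matrix.one_mul, add_zero, Matrix.mul_smul,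
      Matrix.mul_one, neg_zero, Matrix.mul_neg, φ.gg', zero_sub, neg_smul, neg_neg,
      sub_self]
  hB := by
    simp only [Triple.std]
    rw [fromCols_mul_fromBlocks, mul_fromCols]
    simp [φ.gg']
  hD := by
    simp only [Triple.std]
    rw [fromCols_mul_fromBlocks, mul_fromCols, fromRows_mul_fromCols]
    simp only [fromBlocks_multiply, fromBlocks_add, ← fromBlocks_one, fromBlocks_smul,
      fromBlocks_sub, fromBlocks_inj, φ.hA, φ.hB, φ.hD]
    refine ⟨?_, ?_, ?_, ?_⟩
    · simp [Matrix.mul_add, φ.gg', sub_smul]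
      abel
    · simp
    · simp [Matrix.mul_add, Matrix.mul_assoc, φ.gg']
      abel
    · simp [Matrix.mul_assoc]
      abel

end Triple

end IndexOne

/-! ### Normal form, size (1, 1), and the Euclidean induction on triples -/

namespace IndexOne

open Matrix

namespace Triple

variable {K : Type*} [Field K]

section Step

variable {W U : Type} [Fintype W] [DecidableEq W] [Fintype U] [DecidableEq U]

omit [DecidableEq W] [DecidableEq U] in
theorem rank_lt_of_vecMul_eq_zero (B : Matrix W U K) {v : W → K} (hv : v ≠ 0)
    (h : v ᵥ* B = 0) : B.rank < Fintype.card W := by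
  have h1 := LinearMap.finrank_range_add_finrank_ker (Bᵀ.mulVecLin)
  rw [Module.finrank_fintype_fun_eq_card] at h1
  have h2 : 0 < Module.finrank K (LinearMap.ker Bᵀ.mulVecLin) := by
    rw [Module.finrank_pos_iff_exists_ne_zero]
    refine ⟨⟨v, ?_⟩, fun h => hv (congrArg Subtype.val h)⟩
    simp [h]
  have h3 : Module.finrank K (LinearMap.range Bᵀ.mulVecLin) = B.rank := by
    rw [← rank_transpose]
    rfl
  omega

/-- The elements c = u vᵀ with u in the kernel of B stabilize the triple. Since v B = 0 forces the
rank of B below |W|, that kernel has dimension at least |U| - |W| + 1, which is at least two. -/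
theorem two_le_finrank_stab (y : Triple K W U) (hlt : Fintype.card W < Fintype.card U)
    {v : W → K} (hv : v ≠ 0) (h : v ᵥ* y.B = 0) : 2 ≤ Module.finrank K y.stab := by
  have h1 := LinearMap.finrank_range_add_finrank_ker y.B.mulVecLin
  rw [Module.finrank_fintype_fun_eq_card] at h1
  have h2 := rank_lt_of_vecMul_eq_zero y.B hv h
  have h3 : Module.finrank K (LinearMap.range y.B.mulVecLin) = y.B.rank := rfl
  let F : (U → K) →ₗ[K] Ambient K W U :=
    { toFun := fun u => (0, vecMulVec u v, 0, 0, 0)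
      map_add' := by
        intro s t
        simp [add_vecMulVec]
      map_smul' := by
        intro r t
        simp [smul_vecMulVec] }
  have hF : ∀ u ∈ LinearMap.ker y.B.mulVecLin, F u ∈ y.stab := by
    intro u hu
    have hu' : y.B *ᵥ u = 0 := by simpa using hu
    refine ⟨⟨?_, ?_, ?_⟩, ?_, ?_⟩ <;>
      simp [F, mul_vecMulVec, vecMulVec_mul, hu', h]
  have h4 : Module.finrank K (LinearMap.ker y.B.mulVecLin) ≤ Module.finrank K y.stab := by
    refine LinearMap.finrank_le_finrank_of_injective (f := F.restrict hF) ?_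
    rw [← LinearMap.ker_eq_bot, LinearMap.ker_eq_bot']
    rintro ⟨u, hu⟩ h0
    have h5 : ((0, vecMulVec u v, 0, 0, 0) : Ambient K W U) = 0 := congrArg Subtype.val h0
    simp only [Prod.mk_eq_zero] at h5
    obtain ⟨i, hi⟩ := Function.ne_iff.1 hv
    apply Subtype.ext
    funext j
    have := congrFun (congrFun h5.2.1 j) i
    simp only [vecMulVec_apply, Matrix.zero_apply, mul_eq_zero] at this
    exact this.resolve_right hi
  omega

/-- Since B has full row rank, coordinates on U can be chosen in which B is a projection; the lower
left part of the conjugating matrix then clears A. -/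
theorem exists_iso_std (y : Triple K W U) (hlt : Fintype.card W < Fintype.card U)
    (h : ∀ v, v ᵥ* y.B = 0 → v = 0) :
    ∃ (y' : Triple K W (Fin (Fintype.card U - Fintype.card W)))
      (C : Matrix (Fin (Fintype.card U - Fintype.card W)) W K), Nonempty (Iso y (y'.std C)) := by
  obtain ⟨R, hR⟩ : ∃ R : Matrix U W K, y.B * R = 1 := by
    rw [← mulVec_surjective_iff_exists_right_inverse]
    have h1 := LinearMap.finrank_range_add_finrank_ker (y.Bᵀ.mulVecLin)
    have h2 : LinearMap.ker y.Bᵀ.mulVecLin = ⊥ := by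
      rw [LinearMap.ker_eq_bot']
      intro v hv
      apply h
      simpa [mulVec_transpose] using hv
    have h3 : Module.finrank K (LinearMap.range y.Bᵀ.mulVecLin) =
        Module.finrank K (LinearMap.range y.B.mulVecLin) := rank_transpose y.B
    rw [h2, finrank_bot, add_zero, h3] at h1
    have h4 : LinearMap.range y.B.mulVecLin = ⊤ := Submodule.eq_top_of_finrank_eq h1
    exact LinearMap.range_eq_top.1 h4
  have hsurj : LinearMap.range y.B.mulVecLin = ⊤ := by
    rw [LinearMap.range_eq_top]
    exact mulVec_surjective_iff_exists_right_inverse.2 ⟨R, hR⟩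
  have hker : Module.finrank K (LinearMap.ker y.B.mulVecLin) =
      Fintype.card U - Fintype.card W := by
    have h1 := LinearMap.finrank_range_add_finrank_ker y.B.mulVecLin
    rw [hsurj, finrank_top, Module.finrank_fintype_fun_eq_card,
      Module.finrank_fintype_fun_eq_card] at h1
    omega
  set r := Fintype.card U - Fintype.card W with hr
  let e : (Fin r → K) ≃ₗ[K] LinearMap.ker y.B.mulVecLin :=
    LinearEquiv.ofFinrankEq _ _ (by rw [hker, Module.finrank_fintype_fun_eq_card, Fintype.card_fin])
  let P : (U → K) →ₗ[K] LinearMap.ker y.B.mulVecLin :=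
    LinearMap.codRestrict _ (1 - R * y.B).mulVecLin (by
      intro u
      simp only [LinearMap.mem_ker, mulVecLin_apply, mulVec_mulVec, Matrix.mul_sub, Matrix.mul_one]
      rw [← Matrix.mul_assoc, hR]
      simp)
  -- The columns of N form a basis of the kernel of B, and L expresses the projection 1 - R B in
  -- that basis. Hence (R N) and the matrix with rows B and L are mutually inverse.
  let N : Matrix U (Fin r) K :=
    LinearMap.toMatrix' ((LinearMap.ker y.B.mulVecLin).subtype ∘ₗ e.toLinearMap)
  let L : Matrix (Fin r) U K := LinearMap.toMatrix' (e.symm.toLinearMap ∘ₗ P)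
  have hN : y.B * N = 0 := by
    apply Matrix.toLin'.injective
    rw [toLin'_mul, toLin'_toMatrix', map_zero]
    ext1 i
    ext1
    exact (e (Pi.single i 1)).2
  have hNL : N * L = 1 - R * y.B := by
    apply Matrix.toLin'.injective
    rw [toLin'_mul, toLin'_toMatrix', toLin'_toMatrix']
    refine LinearMap.ext fun u => ?_
    simp [P]
  have hk'k : fromCols R N * fromRows y.B L = 1 := by
    rw [fromCols_mul_fromRows, hNL]
    abel
  have hcard : Fintype.card U = Fintype.card (W ⊕ Fin r) := by
    rw [Fintype.card_sum, Fintype.card_fin]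
    omega
  have hkk' : fromRows y.B L * fromCols R N = 1 :=
    (mul_eq_one_comm_of_equiv (Fintype.equivOfCardEq hcard)).1 hk'k
  have hBk' : y.B * fromCols R N = fromCols 1 0 := by
    rw [mul_fromCols, hR, hN]
  -- As B k' = (1 0), this f subtracts exactly A from the first diagonal block.
  let f : Matrix (W ⊕ Fin r) W K := fromRows y.A 0
  let D₂ := fromRows y.B L * (y.D * fromCols R N) + f * (y.B * fromCols R N)
  refine ⟨⟨D₂.toBlocks₁₁, D₂.toBlocks₁₂, D₂.toBlocks₂₂⟩, D₂.toBlocks₂₁, ⟨?_⟩⟩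
  exact
    { g := 1
      g' := 1
      k := fromRows y.B L
      k' := fromCols R N
      f := f
      μ := 0
      ν := 0
      gg' := by simp
      g'g := by simp
      kk' := hkk'
      k'k := hk'k
      hA := by
        rw [← Matrix.mul_assoc y.B, hBk', fromCols_mul_fromRows]
        simp [std]
      hB := by
        rw [hBk']
        simp [std]
      hD := by
        simp only [std, fromBlocks_toBlocks]
        simp [D₂] }

end Step

section Base

variable {W U : Type} [Fintype W] [DecidableEq W] [Fintype U] [DecidableEq U]

/-- A traceless matrix of size one is zero, so only the entry of c is free, and it determines μ and
ν. -/
theorem finrank_stab_of_card_eq_one (y : Triple K W U) (hW : Fintype.card W = 1)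
    (hU : Fintype.card U = 1) : Module.finrank K y.stab = 1 := by
  obtain ⟨iW⟩ := Fintype.card_eq_one_iff_nonempty_unique.1 hW
  obtain ⟨iU⟩ := Fintype.card_eq_one_iff_nonempty_unique.1 hU
  let w : W := default
  let u : U := default
  have hw : ∀ i : W, i = w := fun i => Subsingleton.elim _ _
  have hu : ∀ i : U, i = u := fun i => Subsingleton.elim _ _
  have h1 : ∀ a : Matrix W W K, a.trace = 0 → a = 0 := by
    intro a ha
    ext i j
    simpa [Matrix.trace, hw i, hw j] using ha
  have h2 : ∀ a : Matrix U U K, a.trace = 0 → a = 0 := by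
    intro a ha
    ext i j
    simpa [Matrix.trace, hu i, hu j] using ha
  let t₀ : Ambient K W U := (0, of fun _ _ => 1, 0, -(y.B w u), y.B w u)
  have ht₀ : t₀ ∈ y.stab := by
    refine ⟨⟨?_, ?_, ?_⟩, ?_, ?_⟩
    · ext i j
      rw [hw i, hw j]
      simp [t₀, mul_apply, u]
    · simp [t₀]
    · ext i j
      rw [hu i, hu j]
      simp [t₀, mul_apply, w]
    · simp [t₀]
    · simp [t₀]
  refine finrank_eq_one (⟨t₀, ht₀⟩ : y.stab) ?_ ?_
  · intro h
    have := congrFun (congrFun (congrArg (fun s : y.stab => s.1.2.1) h) u) w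
    simp [t₀] at this
  · rintro ⟨⟨a, c, d, μ, ν⟩, h, ha, hd⟩
    refine ⟨c u w, Subtype.ext ?_⟩
    have ha' := h1 _ ha
    have hd' := h2 _ hd
    simp only at ha' hd'
    subst ha' hd'
    have e1 := congrFun (congrFun h.hA w) w
    have e2 := congrFun (congrFun h.hD u) u
    simp [mul_apply] at e1 e2
    simp only [t₀, Prod.smul_mk, smul_zero, Prod.mk.injEq, SetLike.mk_smul_mk, true_and]
    refine ⟨?_, ?_, ?_⟩
    · ext i j
      rw [hu i, hw j]
      simp
    · rw [← e1]
      simp [w, u, mul_comm]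
    · rw [← e2]
      simp [w, u]

/-- Here a and d are numbers with a - d = N and (a - d) B = -B, so (N + 1) B = 0. -/
theorem IsAdapted.B_eq_zero [CharZero K] {y : Triple K W U} (h : y.IsAdapted)
    (hW : Fintype.card W = 1) (hU : Fintype.card U = 1) : y.B = 0 := by
  obtain ⟨iW⟩ := Fintype.card_eq_one_iff_nonempty_unique.1 hW
  obtain ⟨iU⟩ := Fintype.card_eq_one_iff_nonempty_unique.1 hU
  obtain ⟨a, c, d, μ, ν, h, N, hN⟩ := h
  ext i j
  have e := congrFun (congrFun h.hB i) j
  obtain rfl : i = default := Subsingleton.elim _ _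
  obtain rfl : j = default := Subsingleton.elim _ _
  simp [mul_apply] at e
  simp [Matrix.trace] at hN
  have h0 : (N + 1 : K) * y.B default default = 0 := by
    rw [← hN]
    linear_combination e
  exact (mul_eq_zero.1 h0).resolve_left (by exact_mod_cast Nat.succ_ne_zero N)

variable {W₂ U₂ : Type} [Fintype W₂] [DecidableEq W₂] [Fintype U₂] [DecidableEq U₂]

/-- Once B vanishes, only scalars in the diagonal blocks remain, and these are absorbed by μ and ν.
-/
theorem nonempty_iso_of_card_eq_one {y : Triple K W U} {y₂ : Triple K W₂ U₂}
    (hW : Fintype.card W = 1) (hU : Fintype.card U = 1)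
    (hW₂ : Fintype.card W₂ = 1) (hU₂ : Fintype.card U₂ = 1)
    (hB : y.B = 0) (hB₂ : y₂.B = 0) : Nonempty (Iso y y₂) := by
  obtain ⟨iW⟩ := Fintype.card_eq_one_iff_nonempty_unique.1 hW
  obtain ⟨iU⟩ := Fintype.card_eq_one_iff_nonempty_unique.1 hU
  obtain ⟨iW₂⟩ := Fintype.card_eq_one_iff_nonempty_unique.1 hW₂
  obtain ⟨iU₂⟩ := Fintype.card_eq_one_iff_nonempty_unique.1 hU₂
  refine ⟨{ g := of fun _ _ => 1, g' := of fun _ _ => 1, k := of fun _ _ => 1,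
            k' := of fun _ _ => 1, f := 0, μ := y.A default default - y₂.A default default,
            ν := y.D default default - y₂.D default default,
            gg' := ?_, g'g := ?_, kk' := ?_, k'k := ?_, hA := ?_, hB := ?_, hD := ?_ }⟩
  all_goals first
    | (simp only [hB, hB₂, Matrix.zero_mul, Matrix.mul_zero]; done)
    | (ext i j
       rw [Subsingleton.elim i default, Subsingleton.elim j default]
       simp [mul_apply, hB])

end Base

/-- The stabilizer of a triple is non-zero. -/
theorem one_le_finrank_stab {p q : ℕ} (hp : 0 < p) (hq : 0 < q) (hco : Nat.Coprime p q)
    (W U : Type) [Fintype W] [DecidableEq W] [Fintype U] [DecidableEq U]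
    (hW : Fintype.card W = p) (hU : Fintype.card U = q) (y : Triple K W U) :
    1 ≤ Module.finrank K y.stab := by
  refine coprime_induction (P := fun p q => ∀ (W U : Type) [Fintype W] [DecidableEq W]
    [Fintype U] [DecidableEq U], Fintype.card W = p → Fintype.card U = q →
    ∀ y : Triple K W U, 1 ≤ Module.finrank K y.stab) ?_ ?_ ?_ hp hq hco W U hW hU y
  · intro W U _ _ _ _ hW hU y
    exact (finrank_stab_of_card_eq_one y hW hU).ge
  · intro p r hp hr _ ih W U _ _ _ _ hW hU y
    by_cases h : ∀ v, v ᵥ* y.B = 0 → v = 0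
    · obtain ⟨y', C, ⟨φ⟩⟩ := exists_iso_std y (by omega) h
      rw [φ.finrank_eq, finrank_std]
      exact ih W _ hW (by simp; omega) y'
    · push Not at h
      obtain ⟨v, hv, hv0⟩ := h
      have := two_le_finrank_stab y (by omega) hv0 hv
      omega
  · intro p q _ _ ih W U _ _ _ _ hW hU y
    rw [← finrank_dual]
    exact ih U W hU hW y.dual

/-- Any two adapted triples with one-dimensional stabilizers are isomorphic. -/
theorem nonempty_iso_of_isAdapted [CharZero K] {p q : ℕ} (hp : 0 < p) (hq : 0 < q)
    (hco : Nat.Coprime p q) (W U W₂ U₂ : Type) [Fintype W] [DecidableEq W] [Fintype U]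
    [DecidableEq U] [Fintype W₂] [DecidableEq W₂] [Fintype U₂] [DecidableEq U₂]
    (hW : Fintype.card W = p) (hU : Fintype.card U = q)
    (hW₂ : Fintype.card W₂ = p) (hU₂ : Fintype.card U₂ = q)
    (y : Triple K W U) (y₂ : Triple K W₂ U₂)
    (h : Module.finrank K y.stab = 1) (h₂ : Module.finrank K y₂.stab = 1)
    (ha : y.IsAdapted) (ha₂ : y₂.IsAdapted) : Nonempty (Iso y y₂) := by
  refine coprime_induction (P := fun p q => ∀ (W U W₂ U₂ : Type) [Fintype W] [DecidableEq W]
    [Fintype U] [DecidableEq U] [Fintype W₂] [DecidableEq W₂] [Fintype U₂] [DecidableEq U₂],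
    Fintype.card W = p → Fintype.card U = q → Fintype.card W₂ = p → Fintype.card U₂ = q →
    ∀ (y : Triple K W U) (y₂ : Triple K W₂ U₂), Module.finrank K y.stab = 1 →
    Module.finrank K y₂.stab = 1 → y.IsAdapted → y₂.IsAdapted → Nonempty (Iso y y₂))
    ?_ ?_ ?_ hp hq hco W U W₂ U₂ hW hU hW₂ hU₂ y y₂ h h₂ ha ha₂
  · intro W U W₂ U₂ _ _ _ _ _ _ _ _ hW hU hW₂ hU₂ y y₂ _ _ ha ha₂
    exact nonempty_iso_of_card_eq_one hW hU hW₂ hU₂ (ha.B_eq_zero hW hU)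
      (ha₂.B_eq_zero hW₂ hU₂)
  · intro p r hp hr _ ih W U W₂ U₂ _ _ _ _ _ _ _ _ hW hU hW₂ hU₂ y y₂ h h₂ ha ha₂
    have key : ∀ (W U : Type) [Fintype W] [DecidableEq W] [Fintype U] [DecidableEq U]
        (hW : Fintype.card W = p) (hU : Fintype.card U = p + r) (y : Triple K W U)
        (h : Module.finrank K y.stab = 1) (ha : y.IsAdapted),
        ∃ (y' : Triple K W (Fin (Fintype.card U - Fintype.card W)))
          (C : Matrix (Fin (Fintype.card U - Fintype.card W)) W K),
          Nonempty (Iso y (y'.std C)) ∧ Module.finrank K y'.stab = 1 ∧ y'.IsAdapted := by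
      intro W U _ _ _ _ hW hU y h ha
      obtain ⟨y', C, ⟨φ⟩⟩ := exists_iso_std y (by omega) (by
        intro v hv
        by_contra hv0
        have := two_le_finrank_stab y (by omega) hv0 hv
        omega)
      refine ⟨y', C, ⟨φ⟩, ?_, ?_⟩
      · rw [← finrank_std y' C, ← φ.finrank_eq, h]
      · refine (ha.iso φ rfl ?_).of_std
        simp
        omega
    obtain ⟨y', C, ⟨φ⟩, h', ha'⟩ := key W U hW hU y h ha
    obtain ⟨y₂', C₂, ⟨φ₂⟩, h₂', ha₂'⟩ := key W₂ U₂ hW₂ hU₂ y₂ h₂ ha₂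
    obtain ⟨ψ⟩ := ih W _ W₂ _ hW (by simp; omega) hW₂ (by simp; omega) y' y₂' h' h₂' ha' ha₂'
    exact ⟨(φ.trans (ψ.std C C₂)).trans φ₂.symm⟩
  · intro p q _ _ ih W U W₂ U₂ _ _ _ _ _ _ _ _ hW hU hW₂ hU₂ y y₂ h h₂ ha ha₂
    obtain ⟨φ⟩ := ih U W U₂ W₂ hU hW hU₂ hW₂ y.dual y₂.dual (by rw [finrank_dual, h])
      (by rw [finrank_dual, h₂]) ha.dual ha₂.dual
    exact ⟨φ.dual⟩

end Triple

end IndexOne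

/-! ### Triples supported on the modified cascade -/

namespace IndexOne

open Matrix

namespace Triple

variable {K : Type*} [Field K]

/-- Reindexing a triple. -/
def reindexIso {W U W₂ U₂ : Type} [Fintype W] [DecidableEq W] [Fintype U] [DecidableEq U]
    [Fintype W₂] [DecidableEq W₂] [Fintype U₂] [DecidableEq U₂] (y : Triple K W U)
    (σ : W₂ ≃ W) (τ : U₂ ≃ U) :
    Iso y ⟨y.A.submatrix σ σ, y.B.submatrix σ τ, y.D.submatrix τ τ⟩ where
  g := (1 : Matrix W W K).submatrix σ id
  g' := (1 : Matrix W W K).submatrix id σ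
  k := (1 : Matrix U U K).submatrix τ id
  k' := (1 : Matrix U U K).submatrix id τ
  f := 0
  μ := 0
  ν := 0
  gg' := by
    ext i j
    simp [mul_apply, one_apply]
  g'g := by
    rw [submatrix_mul_equiv 1 1 id σ id]
    simp
  kk' := by
    ext i j
    simp [mul_apply, one_apply]
  k'k := by
    rw [submatrix_mul_equiv 1 1 id τ id]
    simp
  hA := by
    ext i j
    simp [mul_apply, one_apply]
  hB := by
    ext i j
    simp [mul_apply, one_apply]
  hD := by
    ext i j
    simp [mul_apply, one_apply]

/-- The triple cut out of an infinite matrix. -/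
def ofNat (p q : ℕ) (M : ℕ → ℕ → K) : Triple K (Fin p) (Fin q) :=
  ⟨of fun i j => M i j, of fun i u => M i (p + u), of fun u v => M (p + u) (p + v)⟩

theorem nonempty_iso_dual_ofNat (p q : ℕ) (M : ℕ → ℕ → K) :
    Nonempty (Iso (ofNat p q M).dual
      (ofNat q p fun i j => M (p + q - 1 - j) (p + q - 1 - i))) := by
  have h := reindexIso (ofNat p q M).dual (Fin.revPerm : Fin q ≃ Fin q)
    (Fin.revPerm : Fin p ≃ Fin p)
  convert Nonempty.intro h using 2
  ext i j
  · simp only [ofNat, Triple.dual, of_apply, submatrix_apply, transpose_apply, Fin.revPerm_apply,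
      Fin.val_rev]
    congr 1 <;> omega
  · simp only [ofNat, Triple.dual, of_apply, submatrix_apply, transpose_apply, Fin.revPerm_apply,
      Fin.val_rev]
    congr 1 <;> omega
  · simp only [ofNat, Triple.dual, of_apply, submatrix_apply, transpose_apply, Fin.revPerm_apply,
      Fin.val_rev]
    congr 1 <;> omega

/-- The block B has non-zero entries exactly on the antidiagonal, so reversing the second block and
rescaling the first turns it into (1 0). Clearing A then adds a rescaled copy of A to the corner of
the reversed D. This is the matrix form of `cascadeEdge_step`. -/
theorem nonempty_iso_std_ofNat {p r : ℕ} (hr : 0 < r) (M : ℕ → ℕ → K)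
    (hM : ∀ i < p + (p + r), ∀ j < p + (p + r), M i j ≠ 0 ↔ CascadeEdge p (p + r) i j) :
    ∃ (M' : ℕ → ℕ → K) (C : Matrix (Fin r) (Fin p) K),
      (∀ i < p + r, ∀ j < p + r, M' i j ≠ 0 ↔ CascadeEdge p r i j) ∧
      Nonempty (Iso (ofNat p (p + r) M) ((ofNat p r M').std C)) := by
  let β : ℕ → K := fun i => M i (p + (p + r) - 1 - i)
  have hβ : ∀ i < p, β i ≠ 0 := fun i hi => (hM _ (by omega) _ (by omega)).2
    ((cascadeEdge_upper hr hi (by omega)).2 (by omega))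
  let M' : ℕ → ℕ → K := fun k l => M (p + (p + r) - 1 - k) (p + (p + r) - 1 - l) +
    if k < p ∧ l < p then (β k)⁻¹ * (M k l * β l) else 0
  let σ : Fin p ⊕ Fin r ≃ Fin (p + r) := finSumFinEquiv.trans Fin.revPerm
  refine ⟨M', of fun v i => M' (p + v) i, ?_, ?_⟩
  · intro i hi j hj
    rw [cascadeEdge_step hr hi hj, ← hM _ (by omega) _ (by omega)]
    by_cases h : i < p ∧ j < p
    · have h1 : M' i j = M (p + (p + r) - 1 - i) (p + (p + r) - 1 - j) +
          (β i)⁻¹ * (M i j * β j) := by simp only [M', h, and_self, if_true]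
      rw [h1]
      have h2 := hM i (by omega) j (by omega)
      have h3 := hM (p + (p + r) - 1 - i) (by omega) (p + (p + r) - 1 - j) (by omega)
      by_cases h4 : M i j = 0
      · have h5 : ¬ CascadeEdge p (p + r) i j := by
          rw [← h2]
          simpa using h4
        simp [h4, h5]
      · have h5 := h2.1 h4
        -- The two summands of M' have disjoint supports, so nothing cancels and the support is
        -- exact.
        have h6 : M (p + (p + r) - 1 - i) (p + (p + r) - 1 - j) = 0 := by
          by_contra h7
          have := h3.1 h7
          unfold CascadeEdge at this h5
          omega
        simp [h6, h4, h.1, h.2, h5, hβ i h.1, hβ j h.2]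
    · have h1 : M' i j = M (p + (p + r) - 1 - i) (p + (p + r) - 1 - j) := by
        simp only [M', h, if_false, add_zero]
      rw [h1]
      tauto
  · let φ := reindexIso (ofNat p (p + r) M) (Equiv.refl (Fin p)) σ
    let b : Fin p → K := fun i => β i
    have hb : ∀ i, b i ≠ 0 := fun i => hβ i i.2
    have h1 : diagonal b⁻¹ * diagonal b = 1 := by
      rw [diagonal_mul_diagonal, ← diagonal_one]
      congr 1
      funext i
      simp [hb i]
    have h2 : diagonal b * diagonal b⁻¹ = 1 := by
      rw [diagonal_mul_diagonal, ← diagonal_one]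
      congr 1
      funext i
      simp [hb i]
    have hB : (ofNat p (p + r) M).B.submatrix (Equiv.refl (Fin p)) σ =
        fromCols (diagonal b) 0 := by
      ext i (j | j)
      · simp only [σ, ofNat, submatrix_apply, Equiv.refl_apply, Equiv.trans_apply,
          finSumFinEquiv_apply_left, Fin.revPerm_apply, of_apply, Fin.val_rev, Fin.val_castAdd,
          fromCols_apply_inl, diagonal_apply, Fin.ext_iff]
        split_ifs with h
        · simp only [b, β]
          congr 1
          omega
        · by_contra h3
          have := (cascadeEdge_upper hr i.2 (by omega)).1 ((hM _ (by omega) _ (by omega)).1 h3)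
          omega
      · simp only [σ, ofNat, submatrix_apply, Equiv.refl_apply, Equiv.trans_apply,
          finSumFinEquiv_apply_right, Fin.revPerm_apply, of_apply, Fin.val_rev, Fin.val_natAdd,
          fromCols_apply_inr, Matrix.zero_apply]
        by_contra h3
        have := (cascadeEdge_upper hr i.2 (by omega)).1 ((hM _ (by omega) _ (by omega)).1 h3)
        omega
    refine ⟨φ.trans
      { g := diagonal b⁻¹
        g' := diagonal b
        k := 1
        k' := 1
        f := fromRows (diagonal b⁻¹ * ((ofNat p (p + r) M).A * diagonal b)) 0
        μ := 0
        ν := 0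
        gg' := h1
        g'g := h2
        kk' := by simp
        k'k := by simp
        hA := ?_
        hB := ?_
        hD := ?_ }⟩
    · simp only [std, hB, Matrix.one_mul]
      rw [fromCols_mul_fromRows]
      ext i j
      simp [cancel_left h1]
    · simp only [std, hB, Matrix.mul_one]
      rw [mul_fromCols, h1, Matrix.mul_zero]
    · simp only [std, hB, Matrix.mul_one]
      rw [mul_fromCols, h1, Matrix.mul_zero, fromRows_mul_fromCols]
      ext (i | i) (j | j)
      · simp [ofNat, M', b, σ]
        congr 1 <;> omega
      · simp [ofNat, M', σ]
        congr 1 <;> omega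
      · simp [ofNat, M', σ]
        congr 1 <;> omega
      · simp [ofNat, M', σ]
        congr 1 <;> omega

/-- The stabilizer of a triple supported on the modified cascade is one-dimensional. -/
theorem finrank_stab_ofNat {p q : ℕ} (hp : 0 < p) (hq : 0 < q) (hco : Nat.Coprime p q)
    (M : ℕ → ℕ → K) (hM : ∀ i < p + q, ∀ j < p + q, M i j ≠ 0 ↔ CascadeEdge p q i j) :
    Module.finrank K (ofNat p q M).stab = 1 := by
  refine coprime_induction (P := fun p q => ∀ M : ℕ → ℕ → K,
    (∀ i < p + q, ∀ j < p + q, M i j ≠ 0 ↔ CascadeEdge p q i j) →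
    Module.finrank K (ofNat p q M).stab = 1) ?_ ?_ ?_ hp hq hco M hM
  · intro M _
    exact finrank_stab_of_card_eq_one _ (by simp) (by simp)
  · intro p r hp hr _ ih M hM
    obtain ⟨M', C, hM', ⟨φ⟩⟩ := nonempty_iso_std_ofNat hr M hM
    rw [φ.finrank_eq, finrank_std, ih M' hM']
  · intro p q _ _ ih M hM
    obtain ⟨φ⟩ := nonempty_iso_dual_ofNat q p M
    rw [← finrank_dual, φ.finrank_eq]
    refine ih _ fun i hi j hj => ?_
    rw [hM _ (by omega) _ (by omega), add_comm q p]
    exact cascadeEdge_swap hi hj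

end Triple

end IndexOne

/-! ### The Killing form of `sl(n)` and the truncated parabolic -/

namespace IndexOne

open Matrix LieAlgebra LieAlgebra.SpecialLinear

section Killing

variable {K : Type*} [Field K] {n : ℕ}

theorem trace_eq_sum_single (f : Matrix (Fin n) (Fin n) K →ₗ[K] Matrix (Fin n) (Fin n) K) :
    LinearMap.trace K _ f = ∑ i, ∑ j, f (Matrix.single i j 1) i j := by
  rw [LinearMap.trace_eq_matrix_trace K (Matrix.stdBasis K (Fin n) (Fin n)), Matrix.trace,
    Fintype.sum_prod_type]
  refine Finset.sum_congr rfl fun i _ => Finset.sum_congr rfl fun j _ => ?_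
  rw [Matrix.diag_apply, LinearMap.toMatrix_apply, Matrix.stdBasis_eq_single]
  rfl

theorem trace_val_eq_zero (x : sl (Fin n) K) : x.val.trace = 0 := LinearMap.mem_ker.1 x.property

theorem mem_sl_iff {x : Matrix (Fin n) (Fin n) K} : x ∈ sl (Fin n) K ↔ x.trace = 0 :=
  LinearMap.mem_ker

/-- The operator ad x ad z maps all matrices to traceless ones, so its trace may be computed on all
matrices, by summing over matrix units. The terms with tr x tr z vanish. -/
theorem killingForm_sl (x z : sl (Fin n) K) :
    killingForm K (sl (Fin n) K) x z = 2 * n * (x.val * z.val).trace := by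
  let f : Matrix (Fin n) (Fin n) K →ₗ[K] Matrix (Fin n) (Fin n) K :=
    (LinearMap.mulLeft K x.val - LinearMap.mulRight K x.val) ∘ₗ
      (LinearMap.mulLeft K z.val - LinearMap.mulRight K z.val)
  have hf' : ∀ m, f m = x.val * (z.val * m - m * z.val) - (z.val * m - m * z.val) * x.val :=
    fun m => rfl
  have hf : ∀ m, f m ∈ LinearMap.ker (Matrix.traceLinearMap (Fin n) K K) :=
    fun m => LinearMap.mem_ker.2 (by
    rw [hf', Matrix.traceLinearMap_apply, Matrix.trace_sub, Matrix.trace_mul_comm, sub_self])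
  have h1 : killingForm K (sl (Fin n) K) x z = LinearMap.trace K _ f := by
    rw [killingForm_apply_apply,
      ← LinearMap.trace_restrict_eq_of_forall_mem _ f hf]
    rfl
  have h2 : ∀ i j, f (Matrix.single i j 1) i j =
      (x.val * z.val) i i - x.val i i * z.val j j - z.val i i * x.val j j
        + (z.val * x.val) j j := by
    intro i j
    have : f (Matrix.single i j 1) = x.val * z.val * Matrix.single i j 1
        - x.val * Matrix.single i j 1 * z.val - z.val * Matrix.single i j 1 * x.val
        + Matrix.single i j 1 * (z.val * x.val) := by
      rw [hf']
      noncomm_ring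
    rw [this]
    simp only [Matrix.add_apply, Matrix.sub_apply, Matrix.mul_single_apply_same,
      Matrix.single_mul_apply_same, mul_one, one_mul]
    congr 2
    · congr 1
      rw [Matrix.mul_apply, Finset.sum_eq_single j]
      · simp
      · intro k _ hk
        simp [Matrix.mul_single_apply_of_ne, hk]
      · simp
    · rw [Matrix.mul_apply, Finset.sum_eq_single j]
      · simp
      · intro k _ hk
        simp [Matrix.mul_single_apply_of_ne, hk]
      · simp
  have hx := trace_val_eq_zero x
  have hz := trace_val_eq_zero z
  rw [h1, trace_eq_sum_single]
  simp only [h2, Finset.sum_add_distrib, Finset.sum_sub_distrib, Finset.sum_const,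
    Finset.card_univ, Fintype.card_fin, ← Finset.mul_sum, ← Finset.sum_mul, nsmul_eq_mul]
  have e1 : ∑ i, (x.val * z.val) i i = (x.val * z.val).trace := rfl
  have e2 : ∑ i, (z.val * x.val) i i = (x.val * z.val).trace := Matrix.trace_mul_comm _ _
  have e3 : ∑ i, x.val i i = 0 := hx
  rw [e1, e2, e3]
  ring

theorem trace_mul_single (z : Matrix (Fin n) (Fin n) K) (i j : Fin n) :
    (z * Matrix.single i j 1).trace = z j i := by
  rw [Matrix.trace_mul_comm, Matrix.trace_single_mul, one_smul]

/-- The root vector `E_{ij}` of `sl(n)`. -/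
abbrev rootVec {i j : Fin n} (h : i ≠ j) : sl (Fin n) K := SpecialLinear.single i j h 1

/-- The coroot `E_{ii} - E_{jj}` of `sl(n)`. -/
abbrev corootVec (i j : Fin n) : sl (Fin n) K := SpecialLinear.singleSubSingle i j 1

variable [CharZero K]

theorem killingForm_eq_zero_iff (x z : sl (Fin n) K) :
    killingForm K (sl (Fin n) K) x z = 0 ↔ (x.val * z.val).trace = 0 := by
  rw [killingForm_sl]
  rcases Nat.eq_zero_or_pos n with rfl | hn
  · simp [Matrix.trace]
  · have : (2 * n : K) ≠ 0 := by exact_mod_cast (by omega : 2 * n ≠ 0)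
    simp only [mul_eq_zero, this, false_or]

theorem killingForm_injective : Function.Injective (killingForm K (sl (Fin n) K)) := by
  rw [← LinearMap.ker_eq_bot, LinearMap.ker_eq_bot']
  intro z hz
  have h : ∀ b : sl (Fin n) K, (z.val * b.val).trace = 0 := fun b => by
    rw [← killingForm_eq_zero_iff, hz]
    rfl
  have h1 : ∀ i j, i ≠ j → z.val i j = 0 := fun i j hij => by
    have := h (rootVec hij.symm)
    rwa [val_single, trace_mul_single] at this
  have h2 : ∀ i j, z.val i i = z.val j j := fun i j => by
    have := h (corootVec i j)
    rw [val_singleSubSingle, Matrix.mul_sub, Matrix.trace_sub, trace_mul_single,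
      trace_mul_single] at this
    exact sub_eq_zero.1 this
  have h3 := trace_val_eq_zero z
  apply Subtype.ext
  ext i j
  by_cases hij : i = j
  · subst hij
    have h4 : ∑ k : Fin n, z.val k k = 0 := h3
    rw [Finset.sum_congr rfl fun k _ => h2 k i, Finset.sum_const, Finset.card_univ,
      Fintype.card_fin, nsmul_eq_mul, mul_eq_zero] at h4
    have : (n : K) ≠ 0 := by
      have := i.pos
      exact_mod_cast (by omega : n ≠ 0)
    exact h4.resolve_left this
  · exact h1 i j hij

theorem killingForm_surjective : Function.Surjective (killingForm K (sl (Fin n) K)) :=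
  (LinearMap.injective_iff_surjective_of_finrank_eq_finrank
    Subspace.dual_finrank_eq.symm).1 killingForm_injective

theorem restrict_surjective (𝔞 : LieSubalgebra K (sl (Fin n) K)) :
    Function.Surjective (restrict 𝔞) := by
  intro ξ
  obtain ⟨ζ, hζ⟩ := LinearMap.exists_extend (p := 𝔞.toSubmodule) ξ
  obtain ⟨y, hy⟩ := killingForm_surjective ζ
  refine ⟨y, ?_⟩
  ext b
  rw [← hζ, ← hy]
  rfl

omit [CharZero K] in
theorem lie_killingForm (a y : sl (Fin n) K) :
    ⁅a, killingForm K (sl (Fin n) K) y⁆ = killingForm K (sl (Fin n) K) ⁅a, y⁆ := by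
  ext b
  rw [Module.Dual.lie_apply, killingForm_sl, killingForm_sl, sl_bracket, sl_bracket,
    Matrix.mul_sub, Matrix.sub_mul, Matrix.trace_sub, Matrix.trace_sub, ← Matrix.mul_assoc,
    ← Matrix.mul_assoc, Matrix.trace_mul_cycle y.val b.val a.val]
  ring

omit [CharZero K] in
theorem lie_restrict (𝔞 : LieSubalgebra K (sl (Fin n) K)) (a : 𝔞) (y : sl (Fin n) K) :
    ⁅a, restrict 𝔞 y⁆ = restrict 𝔞 ⁅(a : sl (Fin n) K), y⁆ := by
  ext b
  have := LinearMap.congr_fun (lie_killingForm (a : sl (Fin n) K) y) b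
  rw [Module.Dual.lie_apply] at this ⊢
  exact this

end Killing

section Truncated

variable {K : Type*} [Field K] {p q : ℕ}

theorem bracket_mem_truncatedParabolic {x y : sl (Fin (p + q)) K} (hx : x ∈ parabolic K p q)
    (hy : y ∈ parabolic K p q) : ⁅x, y⁆ ∈ truncatedParabolic K p q := by
  refine ⟨⁅(⟨x, hx⟩ : parabolic K p q), ⟨y, hy⟩⁆, ?_, rfl⟩
  have : ⁅(⟨x, hx⟩ : parabolic K p q), ⟨y, hy⟩⁆ ∈ derivedSeries K (parabolic K p q) 1 := by
    rw [derivedSeries_def, derivedSeriesOfIdeal_succ, derivedSeriesOfIdeal_zero]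
    exact LieSubmodule.lie_mem_lie (LieSubmodule.mem_top _) (LieSubmodule.mem_top _)
  exact this

theorem mem_parabolic {x : sl (Fin (p + q)) K} :
    x ∈ parabolic K p q ↔ ∀ i j : Fin (p + q), (i : ℕ) < p → p ≤ (j : ℕ) → x.val i j = 0 :=
  Iff.rfl

theorem corootVec_mem_parabolic (i j : Fin (p + q)) :
    (corootVec i j : sl (Fin (p + q)) K) ∈ parabolic K p q := by
  rw [mem_parabolic]
  intro k l hk hl
  rw [val_singleSubSingle]
  have h : k ≠ l := fun h => by
    subst h
    omega
  simp only [Matrix.sub_apply, Matrix.single_apply]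
  rw [if_neg (fun h' => h (h'.1.symm.trans h'.2)), if_neg (fun h' => h (h'.1.symm.trans h'.2)),
    sub_zero]

theorem rootVec_mem_parabolic {i j : Fin (p + q)} (h : i ≠ j) (hij : ¬ ((i : ℕ) < p ∧ p ≤ (j : ℕ))) :
    (rootVec h : sl (Fin (p + q)) K) ∈ parabolic K p q := by
  rw [mem_parabolic]
  intro k l hk hl
  rw [val_single, Matrix.single_apply, if_neg]
  rintro ⟨rfl, rfl⟩
  exact hij ⟨hk, hl⟩

theorem lie_corootVec_rootVec {i j : Fin (p + q)} (h : i ≠ j) :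
    ⁅(corootVec i j : sl (Fin (p + q)) K), (rootVec h : sl (Fin (p + q)) K)⁆ =
    (2 : K) • rootVec h := by
  apply Subtype.ext
  rw [sl_bracket]
  change _ = (2 : K) • (rootVec h : sl (Fin (p + q)) K).val
  rw [val_singleSubSingle, val_single]
  simp only [Matrix.sub_mul, Matrix.mul_sub, Matrix.single_mul_single_same, mul_one,
    Matrix.single_mul_single_of_ne _ _ _ _ h.symm]
  rw [two_smul]
  abel

theorem lie_rootVec_rootVec {i j : Fin (p + q)} (h : i ≠ j) :
    ⁅(rootVec h : sl (Fin (p + q)) K), (rootVec h.symm : sl (Fin (p + q)) K)⁆ =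
    corootVec i j := by
  apply Subtype.ext
  rw [sl_bracket]
  simp only [val_singleSubSingle, val_single, Matrix.single_mul_single_same, mul_one]

variable [CharZero K]

theorem rootVec_mem_truncatedParabolic {i j : Fin (p + q)} (h : i ≠ j)
    (hij : ¬ ((i : ℕ) < p ∧ p ≤ (j : ℕ))) :
    (rootVec h : sl (Fin (p + q)) K) ∈ truncatedParabolic K p q := by
  have := bracket_mem_truncatedParabolic (corootVec_mem_parabolic i j)
    (rootVec_mem_parabolic h hij : (rootVec h : sl (Fin (p + q)) K) ∈ _)
  rw [lie_corootVec_rootVec] at this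
  have h2 := (truncatedParabolic K p q).smul_mem (2⁻¹ : K) this
  rwa [smul_smul, inv_mul_cancel₀ two_ne_zero, one_smul] at h2

omit [CharZero K] in
theorem corootVec_mem_truncatedParabolic {i j : Fin (p + q)} (hij : (i : ℕ) < p ↔ (j : ℕ) < p) :
    (corootVec i j : sl (Fin (p + q)) K) ∈ truncatedParabolic K p q := by
  by_cases h : i = j
  · subst h
    have : (corootVec i i : sl (Fin (p + q)) K) = 0 := by
      apply Subtype.ext
      rw [val_singleSubSingle, sub_self]
      rfl
    rw [this]
    exact (truncatedParabolic K p q).zero_mem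
  · rw [← lie_rootVec_rootVec h]
    exact bracket_mem_truncatedParabolic (rootVec_mem_parabolic _ (by omega))
      (rootVec_mem_parabolic _ (by omega))

end Truncated

end IndexOne

/-! ### Block coordinates on the truncated parabolic and on its dual -/

namespace IndexOne

open Matrix LieAlgebra LieAlgebra.SpecialLinear

section Blocks

variable {K : Type*} {p q : ℕ}

/-- A matrix of size `p + q` as a block matrix. -/
def blk (M : Matrix (Fin (p + q)) (Fin (p + q)) K) : Matrix (Fin p ⊕ Fin q) (Fin p ⊕ Fin q) K :=
  M.submatrix finSumFinEquiv finSumFinEquiv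

/-- A block matrix as a matrix of size `p + q`. -/
def unblk (M : Matrix (Fin p ⊕ Fin q) (Fin p ⊕ Fin q) K) : Matrix (Fin (p + q)) (Fin (p + q)) K :=
  M.submatrix finSumFinEquiv.symm finSumFinEquiv.symm

theorem blk_unblk (M : Matrix (Fin p ⊕ Fin q) (Fin p ⊕ Fin q) K) : blk (unblk M) = M := by
  simp [blk, unblk]

theorem unblk_blk (M : Matrix (Fin (p + q)) (Fin (p + q)) K) : unblk (blk M) = M := by
  simp [blk, unblk]

theorem blk_injective :
    Function.Injective (blk : Matrix (Fin (p + q)) (Fin (p + q)) K → _) :=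
  Function.LeftInverse.injective unblk_blk

variable [Field K]

theorem blk_mul (M N : Matrix (Fin (p + q)) (Fin (p + q)) K) :
    blk (M * N) = blk M * blk N := by
  simp [blk]

theorem blk_one : blk (1 : Matrix (Fin (p + q)) (Fin (p + q)) K) = 1 := by
  simp [blk]

theorem blk_sub (M N : Matrix (Fin (p + q)) (Fin (p + q)) K) :
    blk (M - N) = blk M - blk N := rfl

theorem trace_blk (M : Matrix (Fin (p + q)) (Fin (p + q)) K) : (blk M).trace = M.trace := by
  simp only [blk, Matrix.trace, Matrix.diag_apply, submatrix_apply]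
  exact Equiv.sum_comp finSumFinEquiv fun i => M i i

/-- The triple of blocks of a matrix. -/
def toTriple (M : Matrix (Fin (p + q)) (Fin (p + q)) K) : Triple K (Fin p) (Fin q) :=
  ⟨(blk M).toBlocks₁₁, (blk M).toBlocks₁₂, (blk M).toBlocks₂₂⟩

omit [Field K] in
theorem blk_eq_fromBlocks (M : Matrix (Fin (p + q)) (Fin (p + q)) K) :
    blk M = fromBlocks (toTriple M).A (toTriple M).B (blk M).toBlocks₂₁ (toTriple M).D :=
  (fromBlocks_toBlocks _).symm

theorem blk_toBlocks₁₂_eq_zero_iff {M : Matrix (Fin (p + q)) (Fin (p + q)) K} :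
    (blk M).toBlocks₁₂ = 0 ↔ ∀ i j : Fin (p + q), (i : ℕ) < p → p ≤ (j : ℕ) → M i j = 0 := by
  constructor
  · intro h i j hi hj
    have := congrFun (congrFun h ⟨i, hi⟩) ⟨j - p, by omega⟩
    simp only [toBlocks₁₂, blk, submatrix_apply, of_apply, finSumFinEquiv_apply_left,
      finSumFinEquiv_apply_right, Matrix.zero_apply] at this
    convert this using 2
    · exact Fin.ext rfl
    · refine Fin.ext ?_
      change (j : ℕ) = p + (j - p)
      omega
  · intro h
    ext i j
    simp only [toBlocks₁₂, blk, submatrix_apply, of_apply, finSumFinEquiv_apply_left,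
      finSumFinEquiv_apply_right, Matrix.zero_apply]
    exact h _ _ (by simp) (by simp)

theorem mem_parabolic_iff_blk {x : sl (Fin (p + q)) K} :
    x ∈ parabolic K p q ↔ (blk x.val).toBlocks₁₂ = 0 :=
  blk_toBlocks₁₂_eq_zero_iff.symm

theorem trace_toBlocks (M : Matrix (Fin (p + q)) (Fin (p + q)) K) :
    (toTriple M).A.trace + (toTriple M).D.trace = M.trace := by
  rw [← trace_blk, blk_eq_fromBlocks M, Triple.trace_fromBlocks]

/-- The upper left block of a commutator of block lower triangular matrices is itself a commutator,
hence traceless. -/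
theorem truncatedParabolic_le {x : sl (Fin (p + q)) K} (hx : x ∈ truncatedParabolic K p q) :
    (blk x.val).toBlocks₁₂ = 0 ∧ (toTriple x.val).A.trace = 0 ∧ (toTriple x.val).D.trace = 0 := by
  obtain ⟨y, hy, rfl⟩ := hx
  have hy' : y ∈ derivedSeries K (parabolic K p q) 1 := hy
  let F : parabolic K p q →ₗ[K] K :=
    { toFun := fun z => (toTriple z.val.val).A.trace
      map_add' := fun a b => Matrix.trace_add (toTriple a.val.val).A (toTriple b.val.val).A
      map_smul' := fun c a => Matrix.trace_smul c (toTriple a.val.val).A }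
  have hF : y ∈ LinearMap.ker F := by
    rw [derivedSeries_def, derivedSeriesOfIdeal_succ, derivedSeriesOfIdeal_zero,
      ← LieSubmodule.mem_toSubmodule, LieSubmodule.lieIdeal_oper_eq_linear_span'] at hy'
    refine (Submodule.span_le.2 ?_) hy'
    rintro - ⟨a, -, b, -, rfl⟩
    have ha := mem_parabolic_iff_blk.1 a.2
    have hb := mem_parabolic_iff_blk.1 b.2
    change (blk (a.val.val * b.val.val - b.val.val * a.val.val)).toBlocks₁₁.trace = 0
    rw [blk_sub, blk_mul, blk_mul, ← fromBlocks_toBlocks (blk a.val.val),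
      ← fromBlocks_toBlocks (blk b.val.val), ha, hb, fromBlocks_multiply, fromBlocks_multiply,
      Triple.fromBlocks_sub, toBlocks_fromBlocks₁₁, Matrix.trace_sub]
    rw [Matrix.zero_mul, Matrix.zero_mul, add_zero, add_zero, Matrix.trace_mul_comm, sub_self]
  refine ⟨mem_parabolic_iff_blk.1 y.2, hF, ?_⟩
  have := trace_toBlocks y.val.val
  rw [trace_val_eq_zero, show (toTriple y.val.val).A.trace = 0 from hF, zero_add] at this
  exact this

variable [CharZero K]

theorem mem_truncatedParabolic_iff (hp : 0 < p) (hq : 0 < q) {x : sl (Fin (p + q)) K} :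
    x ∈ truncatedParabolic K p q ↔ (blk x.val).toBlocks₁₂ = 0 ∧
      (toTriple x.val).A.trace = 0 ∧ (toTriple x.val).D.trace = 0 := by
  refine ⟨truncatedParabolic_le, ?_⟩
  rintro ⟨h, hA, hD⟩
  -- One reference index in each block: the diagonal of x is a combination of the E_ii - E_oo, since
  -- the E_oo terms add up to the block traces, which vanish.
  let o : Fin (p + q) → Fin (p + q) := fun i =>
    if (i : ℕ) < p then ⟨0, by omega⟩ else ⟨p, by omega⟩
  have ho : ∀ i : Fin (p + q), (i : ℕ) < p ↔ (o i : ℕ) < p := by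
    intro i
    by_cases h : (i : ℕ) < p <;> simp [o, h, hp]
  let y : sl (Fin (p + q)) K := ∑ i, ∑ j,
    if h : i = j then x.val i i • corootVec i (o i) else x.val i j • rootVec h
  have hy : y ∈ truncatedParabolic K p q := by
    refine sum_mem fun i _ => sum_mem fun j _ => ?_
    by_cases hij : i = j
    · rw [dif_pos hij]
      exact (truncatedParabolic K p q).smul_mem _ (corootVec_mem_truncatedParabolic (ho i))
    · rw [dif_neg hij]
      by_cases h1 : (i : ℕ) < p ∧ p ≤ (j : ℕ)
      · rw [blk_toBlocks₁₂_eq_zero_iff.1 h i j h1.1 h1.2, zero_smul]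
        exact (truncatedParabolic K p q).zero_mem
      · exact (truncatedParabolic K p q).smul_mem _ (rootVec_mem_truncatedParabolic hij h1)
  have hval : y.val = ∑ i, ∑ j, (Matrix.single i j (x.val i j) -
      if i = j then Matrix.single (o i) (o i) (x.val i i) else 0) := by
    have e : ∀ z : Fin (p + q) → sl (Fin (p + q)) K, (∑ i, z i).val = ∑ i, (z i).val := fun z => by
      induction (Finset.univ : Finset (Fin (p + q))) using Finset.induction_on with
      | empty => rfl
      | insert a s ha ih =>
        rw [Finset.sum_insert ha, Finset.sum_insert ha, ← ih]
        rfl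
    simp only [y, e]
    refine Finset.sum_congr rfl fun i _ => Finset.sum_congr rfl fun j _ => ?_
    by_cases hij : i = j
    · subst hij
      rw [dif_pos rfl, if_pos rfl]
      change x.val i i • (corootVec i (o i) : sl (Fin (p + q)) K).val = _
      rw [val_singleSubSingle, smul_sub, Matrix.smul_single, Matrix.smul_single, smul_eq_mul,
        mul_one]
    · rw [dif_neg hij, if_neg hij]
      change x.val i j • (rootVec hij : sl (Fin (p + q)) K).val = _
      rw [val_single, Matrix.smul_single, smul_eq_mul, mul_one, sub_zero]
  have hxy : y = x := by
    apply Subtype.ext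
    rw [hval]
    simp only [Finset.sum_sub_distrib, Finset.sum_ite_eq, Finset.mem_univ, if_true]
    rw [← Matrix.matrix_eq_sum_single, Fin.sum_univ_add]
    have e1 : ∀ i : Fin p, o (Fin.castAdd q i) = ⟨0, by omega⟩ := fun i => by simp [o]
    have e2 : ∀ i : Fin q, o (Fin.natAdd p i) = ⟨p, by omega⟩ := fun i => by simp [o]
    have s1 : ∑ i : Fin p, x.val (Fin.castAdd q i) (Fin.castAdd q i) = 0 := hA
    have s2 : ∑ i : Fin q, x.val (Fin.natAdd p i) (Fin.natAdd p i) = 0 := hD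
    have key : ∀ {m : ℕ} (k : Fin (p + q)) (f : Fin m → K), ∑ i, f i = 0 →
        ∑ i, Matrix.single k k (f i) = 0 := fun k f hf => by
      have := map_sum (Matrix.singleAddMonoidHom k k : K →+ Matrix (Fin (p + q)) (Fin (p + q)) K)
        f Finset.univ
      rw [hf, map_zero] at this
      exact this.symm
    simp only [e1, e2]
    rw [key _ _ s1, key _ _ s2]
    simp
  rw [← hxy]
  exact hy

theorem apply_eq_zero_of_restrict_eq_zero {z : sl (Fin (p + q)) K}
    (h : restrict (truncatedParabolic K p q) z = 0) {i j : Fin (p + q)} (hij : i ≠ j)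
    (hb : ¬ (p ≤ (i : ℕ) ∧ (j : ℕ) < p)) : z.val i j = 0 := by
  have h1 := LinearMap.congr_fun h ⟨_, rootVec_mem_truncatedParabolic hij.symm (by omega)⟩
  have h2 : (z.val * (rootVec hij.symm : sl (Fin (p + q)) K).val).trace = 0 := by
    rw [← killingForm_eq_zero_iff]
    exact h1
  rwa [val_single, trace_mul_single] at h2

/-- The orthogonal of `𝔭` is `𝔪` together with the centre of the Levi factor, because `𝔭` contains
only the traceless part of each diagonal block. This is why triples carry an indeterminacy by
scalars. -/
theorem restrict_eq_zero_iff (hp : 0 < p) (hq : 0 < q) (z : sl (Fin (p + q)) K) :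
    restrict (truncatedParabolic K p q) z = 0 ↔
      (∃ μ : K, (toTriple z.val).A = μ • 1) ∧ (toTriple z.val).B = 0 ∧
        ∃ ν : K, (toTriple z.val).D = ν • 1 := by
  constructor
  · intro h
    have h0 : ∀ b ∈ truncatedParabolic K p q, (z.val * b.val).trace = 0 := fun b hb => by
      rw [← killingForm_eq_zero_iff]
      exact LinearMap.congr_fun h ⟨b, hb⟩
    have h1 : ∀ i j : Fin (p + q), i ≠ j → ¬ (p ≤ (i : ℕ) ∧ (j : ℕ) < p) → z.val i j = 0 :=
      fun i j => apply_eq_zero_of_restrict_eq_zero h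
    have h2 : ∀ i j : Fin (p + q), ((i : ℕ) < p ↔ (j : ℕ) < p) → z.val i i = z.val j j := by
      intro i j hij
      have := h0 _ (corootVec_mem_truncatedParabolic hij)
      rw [val_singleSubSingle, Matrix.mul_sub, Matrix.trace_sub, trace_mul_single,
        trace_mul_single] at this
      exact sub_eq_zero.1 this
    refine ⟨⟨z.val ⟨0, by omega⟩ ⟨0, by omega⟩, ?_⟩, ?_, ⟨z.val ⟨p, by omega⟩ ⟨p, by omega⟩, ?_⟩⟩
    · ext i j
      change z.val (Fin.castAdd q i) (Fin.castAdd q j) = _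
      by_cases hij : i = j
      · subst hij
        rw [h2 (Fin.castAdd q i) ⟨0, by omega⟩ (by simp [hp])]
        simp
      · rw [h1 _ _ (by simpa using hij) (by simp)]
        simp [hij]
    · ext i j
      change z.val (Fin.castAdd q i) (Fin.natAdd p j) = _
      rw [h1 _ _ (by simp [Fin.ext_iff]; omega) (by simp)]
      rfl
    · ext i j
      change z.val (Fin.natAdd p i) (Fin.natAdd p j) = _
      by_cases hij : i = j
      · subst hij
        rw [h2 (Fin.natAdd p i) ⟨p, by omega⟩ (by simp)]
        simp
      · rw [h1 _ _ (by simpa using hij) (by simp)]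
        simp [hij]
  · rintro ⟨⟨μ, hA⟩, hB, ν, hD⟩
    ext b
    obtain ⟨b1, b2, b3⟩ := truncatedParabolic_le b.2
    change killingForm K _ z b.val = 0
    rw [killingForm_eq_zero_iff, ← trace_blk, blk_mul, blk_eq_fromBlocks z.val,
      blk_eq_fromBlocks b.val.val, fromBlocks_multiply, Triple.trace_fromBlocks, hA, hB, hD]
    have : (toTriple b.val.val).B = 0 := b1
    simp [b2, b3, this]

/-- This is the dictionary between functionals and triples: ε = 0 describes stabilizers and ε = -1
adapted pairs, while μ and ν come from the kernel of restriction. -/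
theorem lie_restrict_eq_smul_iff (hp : 0 < p) (hq : 0 < q) (a : truncatedParabolic K p q)
    (y : sl (Fin (p + q)) K) (ε : K) :
    ⁅a, restrict (truncatedParabolic K p q) y⁆ = ε • restrict (truncatedParabolic K p q) y ↔
      ∃ μ ν, (toTriple y.val).IsDer ε (toTriple a.val.val).A (blk a.val.val).toBlocks₂₁
        (toTriple a.val.val).D μ ν := by
  rw [lie_restrict, ← sub_eq_zero, ← map_smul, ← map_sub, restrict_eq_zero_iff hp hq]
  have hb : (toTriple a.val.val).B = 0 := (truncatedParabolic_le a.2).1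
  have e : blk (⁅a.val, y⁆ - ε • y).val = blk a.val.val * blk y.val - blk y.val * blk a.val.val
      - ε • blk y.val := by
    rw [← blk_mul, ← blk_mul]
    rfl
  rw [blk_eq_fromBlocks a.val.val, blk_eq_fromBlocks y.val, hb, fromBlocks_multiply,
    fromBlocks_multiply, fromBlocks_smul, Triple.fromBlocks_sub, Triple.fromBlocks_sub] at e
  have eA : (toTriple (⁅a.val, y⁆ - ε • y).val).A = _ := congrArg toBlocks₁₁ e
  have eB : (toTriple (⁅a.val, y⁆ - ε • y).val).B = _ := congrArg toBlocks₁₂ e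
  have eD : (toTriple (⁅a.val, y⁆ - ε • y).val).D = _ := congrArg toBlocks₂₂ e
  simp only [toBlocks_fromBlocks₁₁, toBlocks_fromBlocks₁₂, toBlocks_fromBlocks₂₂] at eA eB eD
  rw [eA, eB, eD]
  simp only [Matrix.zero_mul, Matrix.mul_zero, add_zero, zero_add]
  constructor
  · rintro ⟨⟨μ, h1⟩, h2, ν, h3⟩
    refine ⟨μ, ν, ?_, ?_, ?_⟩
    · rw [← h1]
      abel
    · exact sub_eq_zero.1 h2
    · rw [← h3]
      abel
  · rintro ⟨μ, ν, h1, h2, h3⟩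
    refine ⟨⟨μ, ?_⟩, sub_eq_zero.2 h2, ν, ?_⟩
    · rw [sub_eq_iff_eq_add, add_comm (μ • _), ← h1]
      abel
    · rw [sub_eq_iff_eq_add, add_comm (ν • _), ← h3]

/-- The diagonal and lower left blocks of an element of the truncated parabolic. -/
def blockCoords : truncatedParabolic K p q →ₗ[K]
    Matrix (Fin p) (Fin p) K × Matrix (Fin q) (Fin p) K × Matrix (Fin q) (Fin q) K where
  toFun a := ((toTriple a.val.val).A, (blk a.val.val).toBlocks₂₁, (toTriple a.val.val).D)
  map_add' _ _ := rfl
  map_smul' _ _ := rfl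

omit [CharZero K] in
theorem blockCoords_injective : Function.Injective (blockCoords (K := K) (p := p) (q := q)) := by
  rw [← LinearMap.ker_eq_bot, LinearMap.ker_eq_bot']
  intro a ha
  have h : ((toTriple a.val.val).A, (blk a.val.val).toBlocks₂₁, (toTriple a.val.val).D) = 0 := ha
  simp only [Prod.mk_eq_zero] at h
  have hb : (toTriple a.val.val).B = 0 := (truncatedParabolic_le a.2).1
  apply Subtype.ext
  apply Subtype.ext
  apply blk_injective
  rw [blk_eq_fromBlocks a.val.val, h.1, h.2.1, h.2.2, hb, fromBlocks_zero]
  rfl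

/-- The scalars μ and ν are determined by a, c and d, as one diagonal entry of each block equation
shows, so forgetting them does not change the dimension. -/
theorem finrank_stabilizer_restrict (hp : 0 < p) (hq : 0 < q) (y : sl (Fin (p + q)) K) :
    Module.finrank K (stabilizer (restrict (truncatedParabolic K p q) y)) =
      Module.finrank K (toTriple y.val).stab := by
  let π : Triple.Ambient K (Fin p) (Fin q) →ₗ[K]
      Matrix (Fin p) (Fin p) K × Matrix (Fin q) (Fin p) K × Matrix (Fin q) (Fin q) K :=
    { toFun := fun t => (t.1, t.2.1, t.2.2.1)
      map_add' := fun _ _ => rfl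
      map_smul' := fun _ _ => rfl }
  have hπ : Function.Injective (π.domRestrict (toTriple y.val).stab) := by
    rw [← LinearMap.ker_eq_bot, LinearMap.ker_eq_bot']
    rintro ⟨⟨a, c, d, μ, ν⟩, ⟨h, h2, h3⟩⟩ h0
    have h1 : (a, c, d) = 0 := h0
    simp only [Prod.mk_eq_zero] at h1
    obtain ⟨rfl, rfl, rfl⟩ := h1
    have e1 := congrFun (congrFun h.hA ⟨0, hp⟩) ⟨0, hp⟩
    have e2 := congrFun (congrFun h.hD ⟨0, hq⟩) ⟨0, hq⟩
    simp at e1 e2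
    simp [← e1, ← e2]
  have hmap : (stabilizer (restrict (truncatedParabolic K p q) y)).map blockCoords =
      (toTriple y.val).stab.map π := by
    ext ⟨a, c, d⟩
    constructor
    · rintro ⟨b, hb, hbe⟩
      have hb0 : ⁅b, restrict (truncatedParabolic K p q) y⁆ =
        (0 : K) • restrict (truncatedParabolic K p q) y := by
        rw [zero_smul]
        exact hb
      obtain ⟨μ, ν, h⟩ := (lie_restrict_eq_smul_iff hp hq b y 0).1 hb0
      have hb' := truncatedParabolic_le b.2
      rw [← hbe]
      exact ⟨(_, _, _, μ, ν), ⟨h, hb'.2.1, hb'.2.2⟩, rfl⟩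
    · rintro ⟨⟨a', c', d', μ, ν⟩, ⟨h, ha, hd⟩, h2⟩
      have h3 : (a', c', d') = (a, c, d) := h2
      simp only [Prod.mk.injEq] at h3
      obtain ⟨rfl, rfl, rfl⟩ := h3
      simp only at h ha hd
      let z : sl (Fin (p + q)) K := ⟨unblk (fromBlocks a' 0 c' d'), mem_sl_iff.2 (by
        rw [← trace_blk, blk_unblk, Triple.trace_fromBlocks, ha, hd, add_zero])⟩
      have hz : blk z.val = fromBlocks a' 0 c' d' := blk_unblk _
      have hzA : (toTriple z.val).A = a' := by
        change (blk z.val).toBlocks₁₁ = _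
        rw [hz, toBlocks_fromBlocks₁₁]
      have hzD : (toTriple z.val).D = d' := by
        change (blk z.val).toBlocks₂₂ = _
        rw [hz, toBlocks_fromBlocks₂₂]
      have hzC : (blk z.val).toBlocks₂₁ = c' := by
        rw [hz, toBlocks_fromBlocks₂₁]
      have hzm : z ∈ truncatedParabolic K p q := by
        rw [mem_truncatedParabolic_iff hp hq, hzA, hzD, hz, toBlocks_fromBlocks₁₂]
        exact ⟨rfl, ha, hd⟩
      refine ⟨⟨z, hzm⟩, ?_, ?_⟩
      · have := (lie_restrict_eq_smul_iff hp hq ⟨z, hzm⟩ y 0).2 ⟨μ, ν, by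
          rw [hzA, hzD, hzC]
          exact h⟩
        rw [zero_smul] at this
        exact this
      · change ((toTriple z.val).A, (blk z.val).toBlocks₂₁, (toTriple z.val).D) = _
        rw [hzA, hzD, hzC]
  rw [LinearEquiv.finrank_eq (Submodule.equivMapOfInjective _ blockCoords_injective _), hmap,
    ← LinearMap.range_domRestrict, LinearMap.finrank_range_of_inj hπ]

end Blocks

end IndexOne

/-! ### Regular nilpotent elements of `sl(n)` -/

namespace IndexOne

open Matrix LieAlgebra LieAlgebra.SpecialLinear

section Centralizer

open Polynomial DirectSum

/-- Every endomorphism commutes with a space of endomorphisms of dimension at least that of the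
underlying space. -/
theorem finrank_le_finrank_centralizer {K V : Type*} [Field K] [AddCommGroup V] [Module K V]
    [FiniteDimensional K V] (f : Module.End K V) :
    Module.finrank K V ≤
      Module.finrank K (LinearMap.ker (LinearMap.mulLeft K f - LinearMap.mulRight K f)) := by
  classical
  obtain ⟨ι, _, P, _, k, ⟨e⟩⟩ := Module.equiv_directSum_of_isTorsion
    (Module.AEval.isTorsion_of_finiteDimensional K V f)
  let E := e.trans (DirectSum.linearEquivFunOnFintype K[X] ι fun i => K[X] ⧸ Ideal.span {P i ^ k i})
  let o : V ≃ₗ[K] Module.AEval' f := Module.AEval'.of f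
  have hE : ∀ (c : K) (v : V), E (o (c • v)) = (C c : K[X]) • E (o v) := fun c v => by
    have : o (c • v) = (C c : K[X]) • o v := by rw [Module.AEval.C_smul, map_smul]
    rw [this, map_smul]
  have hE' : ∀ (c : K) s, o.symm (E.symm ((C c : K[X]) • s)) = c • o.symm (E.symm s) := fun c v => by
    rw [map_smul, Module.AEval.C_smul, map_smul]
  have hX : ∀ v : V, E (o (f v)) = (X : K[X]) • E (o v) := fun v => by
    rw [← map_smul]
    congr 1
    exact (Module.AEval.X_smul_of f v).symm
  -- As a K[X]-module with X acting by f, V is a finite product of quotients of K[X], hence carries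
  -- a commutative ring structure. Multiplication by v commutes with X, and its value at 1 recovers
  -- v.
  let Θ : V →ₗ[K] Module.End K V :=
    LinearMap.mk₂ K (fun v w => o.symm (E.symm (E (o v) * E (o w))))
      (fun a b c => by simp [add_mul])
      (fun a b c => by rw [hE, smul_mul_assoc, hE'])
      (fun a b c => by simp [mul_add])
      (fun a b c => by rw [hE, mul_smul_comm, hE'])
  have hΘ : ∀ v w, Θ v w = o.symm (E.symm (E (o v) * E (o w))) := fun _ _ => rfl
  have hmem : ∀ v, Θ v ∈ LinearMap.ker (LinearMap.mulLeft K f - LinearMap.mulRight K f) := by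
    intro v
    rw [LinearMap.mem_ker, LinearMap.sub_apply, LinearMap.mulLeft_apply, LinearMap.mulRight_apply,
      sub_eq_zero]
    ext w
    apply o.injective
    apply E.injective
    rw [Module.End.mul_apply, Module.End.mul_apply, hX, hΘ, hΘ, hX, mul_smul_comm]
    simp
  refine LinearMap.finrank_le_finrank_of_injective (f := Θ.codRestrict _ hmem) ?_
  rw [← LinearMap.ker_eq_bot, LinearMap.ker_eq_bot']
  intro v hv
  have h1 : Θ v (o.symm (E.symm 1)) = 0 := by
    have : Θ v = 0 := congrArg Subtype.val hv
    rw [this]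
    rfl
  rw [hΘ] at h1
  simpa using h1

end Centralizer

variable {K : Type*} [Field K] {n : ℕ}

/-- The matrices commuting with a given one. -/
def centralizer (z : Matrix (Fin n) (Fin n) K) : Submodule K (Matrix (Fin n) (Fin n) K) :=
  LinearMap.ker (LinearMap.mulLeft K z - LinearMap.mulRight K z)

theorem mem_centralizer {z a : Matrix (Fin n) (Fin n) K} : a ∈ centralizer z ↔ z * a = a * z := by
  simp [centralizer, sub_eq_zero]

theorem le_finrank_centralizer (z : Matrix (Fin n) (Fin n) K) :
    n ≤ Module.finrank K (centralizer z) := by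
  have h := finrank_le_finrank_centralizer (Matrix.toLinAlgEquiv' z)
  rw [Module.finrank_fintype_fun_eq_card, Fintype.card_fin] at h
  refine h.trans ?_
  let F := (LinearMap.toMatrixAlgEquiv' : _ ≃ₐ[K] Matrix (Fin n) (Fin n) K).toLinearEquiv.toLinearMap
  have hF : ∀ g ∈ LinearMap.ker (LinearMap.mulLeft K (Matrix.toLinAlgEquiv' z) -
      LinearMap.mulRight K (Matrix.toLinAlgEquiv' z)), F g ∈ centralizer z := by
    intro g hg
    rw [LinearMap.mem_ker, LinearMap.sub_apply, sub_eq_zero, LinearMap.mulLeft_apply,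
      LinearMap.mulRight_apply] at hg
    rw [mem_centralizer]
    have := congrArg LinearMap.toMatrixAlgEquiv' hg
    rwa [map_mul, map_mul, LinearMap.toMatrixAlgEquiv'_toLinAlgEquiv'] at this
  refine LinearMap.finrank_le_finrank_of_injective (f := F.restrict hF) ?_
  intro a b hab
  exact Subtype.ext (LinearMap.toMatrixAlgEquiv'.injective (congrArg Subtype.val hab))

variable [CharZero K]

theorem mem_stabilizer_killingForm {y a : sl (Fin n) K} :
    a ∈ stabilizer (killingForm K (sl (Fin n) K) y) ↔ a.val ∈ centralizer y.val := by
  have : a ∈ stabilizer (killingForm K (sl (Fin n) K) y) ↔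
      ⁅a, killingForm K (sl (Fin n) K) y⁆ = 0 := Iff.rfl
  rw [this, lie_killingForm, mem_centralizer]
  constructor
  · intro h
    have h1 : ⁅a, y⁆ = 0 := killingForm_injective (by rw [h, map_zero])
    have h2 : a.val * y.val - y.val * a.val = 0 := congrArg Subtype.val h1
    exact (sub_eq_zero.1 h2).symm
  · intro h
    have h1 : ⁅a, y⁆ = 0 := by
      apply Subtype.ext
      rw [sl_bracket, h, sub_self]
      rfl
    rw [h1, map_zero]

/-- The stabilizer is the traceless part of the centralizer, which has dimension at least n. -/
theorem le_finrank_stabilizer_killingForm (y : sl (Fin n) K) :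
    n - 1 ≤ Module.finrank K (stabilizer (killingForm K (sl (Fin n) K) y)) := by
  let T : centralizer y.val →ₗ[K] K := (Matrix.traceLinearMap (Fin n) K K) ∘ₗ Submodule.subtype _
  have h1 := LinearMap.finrank_range_add_finrank_ker T
  have h2 : Module.finrank K (LinearMap.range T) ≤ 1 :=
    (Submodule.finrank_le _).trans (Module.finrank_self K).le
  have h3 := le_finrank_centralizer y.val
  let G : LinearMap.ker T →ₗ[K] stabilizer (killingForm K (sl (Fin n) K) y) :=
    { toFun := fun a => ⟨⟨a.val.val, mem_sl_iff.2 a.2⟩, mem_stabilizer_killingForm.2 a.val.2⟩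
      map_add' := fun _ _ => rfl
      map_smul' := fun _ _ => rfl }
  have h4 : Module.finrank K (LinearMap.ker T) ≤
      Module.finrank K (stabilizer (killingForm K (sl (Fin n) K) y)) := by
    refine LinearMap.finrank_le_finrank_of_injective (f := G) ?_
    intro a b hab
    apply Subtype.ext
    apply Subtype.ext
    exact congrArg (fun z => z.val.val) hab
  omega

omit [CharZero K] in
theorem conj_val (g : GL (Fin n) K) (y : sl (Fin n) K) :
    (conj g y).val = g.val * y.val * g⁻¹.val := rfl

omit [CharZero K] in
theorem conj_mul (g h : GL (Fin n) K) (y : sl (Fin n) K) :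
    conj (g * h) y = conj g (conj h y) := by
  apply Subtype.ext
  change (g * h).val * y.val * (g * h)⁻¹.val = g.val * (h.val * y.val * h⁻¹.val) * g⁻¹.val
  rw [_root_.mul_inv_rev, Units.val_mul, Units.val_mul]
  simp only [mul_assoc]

omit [CharZero K] in
theorem conj_one (y : sl (Fin n) K) : conj 1 y = y := by
  apply Subtype.ext
  change (1 : GL (Fin n) K).val * y.val * (1 : GL (Fin n) K)⁻¹.val = y.val
  simp

theorem finrank_stabilizer_conj_le (g : GL (Fin n) K) (y : sl (Fin n) K) :
    Module.finrank K (stabilizer (killingForm K (sl (Fin n) K) y)) ≤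
      Module.finrank K (stabilizer (killingForm K (sl (Fin n) K) (conj g y))) := by
  have key : ∀ a b : Matrix (Fin n) (Fin n) K,
      g.val * a * g⁻¹.val * (g.val * b * g⁻¹.val) = g.val * (a * b) * g⁻¹.val := fun a b => by
    simp only [mul_assoc, Units.inv_mul_cancel_left]
  let F : sl (Fin n) K →ₗ[K] sl (Fin n) K :=
    { toFun := conj g
      map_add' := fun a b => by
        apply Subtype.ext
        change g.val * (a.val + b.val) * g⁻¹.val =
          g.val * a.val * g⁻¹.val + g.val * b.val * g⁻¹.val
        rw [mul_add, add_mul]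
      map_smul' := fun c a => by
        apply Subtype.ext
        change g.val * (c • a.val) * g⁻¹.val = c • (g.val * a.val * g⁻¹.val)
        rw [Matrix.mul_smul, Matrix.smul_mul] }
  have hF : ∀ a ∈ stabilizer (killingForm K (sl (Fin n) K) y),
      F a ∈ stabilizer (killingForm K (sl (Fin n) K) (conj g y)) := by
    intro a ha
    rw [mem_stabilizer_killingForm, mem_centralizer] at ha ⊢
    change g.val * y.val * g⁻¹.val * (g.val * a.val * g⁻¹.val) =
      g.val * a.val * g⁻¹.val * (g.val * y.val * g⁻¹.val)
    rw [key, key, ha]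
  refine LinearMap.finrank_le_finrank_of_injective (f := F.restrict hF) ?_
  intro a b hab
  have h : conj g a.val = conj g b.val := congrArg Subtype.val hab
  have := congrArg (conj g⁻¹) h
  rw [← conj_mul, ← conj_mul, inv_mul_cancel, conj_one, conj_one] at this
  exact Subtype.ext this

/-- A nilpotent matrix with nilpotency and a small centralizer gives a regular nilpotent. -/
theorem mem_regularNilpotents {y : sl (Fin n) K} (h : IsNilpotent y.val)
    (h' : Module.finrank K (stabilizer (killingForm K (sl (Fin n) K) y)) ≤ n - 1) :
    y ∈ regularNilpotents K (sl (Fin n) K) := by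
  refine ⟨LieAlgebra.isNilpotent_ad_of_isNilpotent h, ?_⟩
  have hle : ∀ ξ : Module.Dual K (sl (Fin n) K), n - 1 ≤ Module.finrank K (stabilizer ξ) := by
    intro ξ
    obtain ⟨z, rfl⟩ := killingForm_surjective ξ
    exact le_finrank_stabilizer_killingForm z
  refine le_antisymm (h'.trans (le_ciInf hle)) (ciInf_le (OrderBot.bddBelow _) _)

omit [CharZero K] in
theorem conj_pow (g : GL (Fin n) K) (M : Matrix (Fin n) (Fin n) K) (k : ℕ) :
    (g.val * M * g⁻¹.val) ^ k = g.val * M ^ k * g⁻¹.val := by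
  induction k with
  | zero => simp
  | succ k ih =>
    rw [pow_succ, ih, pow_succ]
    simp only [mul_assoc, Units.inv_mul_cancel_left]

/-- A matrix whose only non-zero entries are the entries of the first superdiagonal. -/
structure IsSuperdiagonal (N : Matrix (Fin n) (Fin n) K) : Prop where
  ne_zero_iff : ∀ i j, N i j ≠ 0 ↔ (j : ℕ) = i + 1

omit [CharZero K] in
theorem IsSuperdiagonal.isNilpotent {N : Matrix (Fin n) (Fin n) K} (h : IsSuperdiagonal N) :
    IsNilpotent N := by
  have key : ∀ m i j, (N ^ m) i j ≠ 0 → (j : ℕ) = i + m := by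
    intro m
    induction m with
    | zero =>
      intro i j hij
      by_contra hne
      apply hij
      rw [pow_zero, Matrix.one_apply_ne]
      rintro rfl
      exact hne rfl
    | succ m ih =>
      intro i j hij
      rw [pow_succ, Matrix.mul_apply] at hij
      obtain ⟨k, -, hk⟩ := Finset.exists_ne_zero_of_sum_ne_zero hij
      have h1 := ih i k (left_ne_zero_of_mul hk)
      have h2 := (h.ne_zero_iff k j).1 (right_ne_zero_of_mul hk)
      omega
  refine ⟨n, ?_⟩
  ext i j
  by_contra hij
  have := key n i j hij
  omega

omit [CharZero K] in
-- Comparing column j + 1 in a N = N a expresses column j of a through column j + 1, so the last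
-- column determines a.
theorem IsSuperdiagonal.eq_zero_of_mem_centralizer {N : Matrix (Fin n) (Fin n) K}
    (h : IsSuperdiagonal N) {a : Matrix (Fin n) (Fin n) K} (ha : a ∈ centralizer N)
    (h0 : ∀ i j : Fin n, (j : ℕ) + 1 = n → a i j = 0) : a = 0 := by
  rw [mem_centralizer] at ha
  have key : ∀ m, ∀ i j : Fin n, (j : ℕ) + 1 + m = n → a i j = 0 := by
    intro m
    induction m with
    | zero => exact fun i j hj => h0 i j hj
    | succ m ih =>
      intro i j hj
      let j' : Fin n := ⟨j + 1, by omega⟩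
      have e := congrFun (congrFun ha i) j'
      rw [Matrix.mul_apply, Matrix.mul_apply, Finset.sum_eq_zero, Finset.sum_eq_single j] at e
      · exact (mul_eq_zero.1 e.symm).resolve_right ((h.ne_zero_iff j j').2 rfl)
      · intro k _ hk
        have : N k j' = 0 := by
          by_contra h1
          have := (h.ne_zero_iff k j').1 h1
          exact hk (Fin.ext (by simp only [j'] at this; omega))
        rw [this, mul_zero]
      · simp
      · intro k _
        rw [ih k j' (by simp only [j']; omega), mul_zero]
  ext i j
  exact key (n - 1 - j) i j (by omega)

/-- Taking the last column embeds the stabilizer into K^n. The last basis vector is not attained: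
only the identity could give it, and its trace n is not zero. -/
theorem IsSuperdiagonal.finrank_le {y : sl (Fin n) K} (h : IsSuperdiagonal y.val) :
    Module.finrank K (stabilizer (killingForm K (sl (Fin n) K) y)) ≤ n - 1 := by
  rcases Nat.eq_zero_or_pos n with rfl | hn
  · have : Module.finrank K (sl (Fin 0) K) = 0 := by
      have : Subsingleton (sl (Fin 0) K) := ⟨fun a b => Subtype.ext (Subsingleton.elim _ _)⟩
      exact Module.finrank_zero_of_subsingleton
    exact (Submodule.finrank_le _).trans this.le
  · let l : Fin n := ⟨n - 1, by omega⟩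
    let F : stabilizer (killingForm K (sl (Fin n) K) y) →ₗ[K] (Fin n → K) :=
      { toFun := fun a i => a.val.val i l
        map_add' := fun _ _ => rfl
        map_smul' := fun _ _ => rfl }
    have hl : ∀ j : Fin n, (j : ℕ) + 1 = n → j = l := fun j hj => Fin.ext (by simp only [l]; omega)
    have hinj : Function.Injective F := by
      rw [← LinearMap.ker_eq_bot, LinearMap.ker_eq_bot']
      intro a ha
      apply Subtype.ext
      apply Subtype.ext
      refine h.eq_zero_of_mem_centralizer (mem_stabilizer_killingForm.1 a.2) fun i j hj => ?_
      rw [hl j hj]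
      exact congrFun ha i
    have hne : LinearMap.range F ≠ ⊤ := by
      intro htop
      obtain ⟨a, ha⟩ := LinearMap.range_eq_top.1 htop (Pi.single l 1)
      have h1 : a.val.val - 1 = 0 := by
        refine h.eq_zero_of_mem_centralizer (Submodule.sub_mem _
          (mem_stabilizer_killingForm.1 a.2) (by rw [mem_centralizer, mul_one, one_mul]))
          fun i j hj => ?_
        have := congrFun ha i
        rw [hl j hj, Matrix.sub_apply, Matrix.one_apply, sub_eq_zero]
        rw [Pi.single_apply] at this
        exact this
      have h2 := trace_val_eq_zero a.val
      rw [sub_eq_zero.1 h1, Matrix.trace_one, Fintype.card_fin] at h2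
      exact hn.ne' (by exact_mod_cast h2)
    have h3 := Submodule.finrank_lt hne
    rw [LinearMap.finrank_range_of_inj hinj, Module.finrank_fintype_fun_eq_card,
      Fintype.card_fin] at h3
    omega

theorem IsSuperdiagonal.conj_mem {y : sl (Fin n) K} (h : IsSuperdiagonal y.val)
    (g : GL (Fin n) K) : conj g y ∈ regularNilpotents K (sl (Fin n) K) := by
  refine mem_regularNilpotents ?_ ?_
  · obtain ⟨m, hm⟩ := h.isNilpotent
    refine ⟨m, ?_⟩
    rw [conj_val, conj_pow, hm, mul_zero, zero_mul]
  · refine (finrank_stabilizer_conj_le g⁻¹ _).trans ?_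
    rw [← conj_mul, inv_mul_cancel, conj_one]
    exact h.finrank_le

/-- A strictly upper triangular matrix without zeros on the first superdiagonal is conjugate under
the upper triangular group to any matrix supported exactly on the first superdiagonal. -/
theorem IsSuperdiagonal.exists_conj {y : Matrix (Fin n) (Fin n) K} (h : IsSuperdiagonal y)
    (N : Matrix (Fin n) (Fin n) K) (hN : ∀ i j, N i j ≠ 0 → i < j)
    (hN' : ∀ i j : Fin n, (j : ℕ) = i + 1 → N i j ≠ 0) :
    ∃ b : GL (Fin n) K, b.val.BlockTriangular id ∧ N * b.val = b.val * y := by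
  rcases Nat.eq_zero_or_pos n with rfl | hn
  · exact ⟨1, fun i => i.elim0, Subsingleton.elim _ _⟩
  have last : ∃ v : ℕ → Fin n → K,
      (∀ m < n, ∀ i : Fin n, n - 1 - m < i → v m i = 0) ∧
      (∀ m < n, ∀ i : Fin n, (i : ℕ) = n - 1 - m → v m i ≠ 0) ∧
      (∀ m, ∀ i j : Fin n, (j : ℕ) = n - 1 - m → (j : ℕ) = i + 1 →
        N *ᵥ v m = y i j • v (m + 1)) := by
    -- The vector v m is column n - 1 - m of b. Starting from the last basis vector, N is applied
    -- and the result divided by the superdiagonal entry of y, so that N b_j = y_(j-1,j) b_(j-1).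
    let v : ℕ → Fin n → K := fun m => Nat.rec (Pi.single ⟨n - 1, by omega⟩ 1)
      (fun m w => if hm : m + 1 < n then
        (y ⟨n - 1 - (m + 1), by omega⟩ ⟨n - 1 - m, by omega⟩)⁻¹ • (N *ᵥ w) else 0) m
    have hv0 : v 0 = Pi.single ⟨n - 1, by omega⟩ 1 := rfl
    have hvs : ∀ m (hm : m + 1 < n), v (m + 1) =
        (y ⟨n - 1 - (m + 1), by omega⟩ ⟨n - 1 - m, by omega⟩)⁻¹ • (N *ᵥ v m) := fun m hm =>
      dif_pos hm
    have hy : ∀ m (hm : m + 1 < n),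
        y ⟨n - 1 - (m + 1), by omega⟩ ⟨n - 1 - m, by omega⟩ ≠ 0 := fun m hm =>
      (h.ne_zero_iff _ _).2 (by simp only; omega)
    have h1 : ∀ m < n, ∀ i : Fin n, n - 1 - m < i → v m i = 0 := by
      intro m
      induction m with
      | zero =>
        intro _ i hi
        omega
      | succ m ih =>
        intro hm i hi
        rw [hvs m hm, Pi.smul_apply, mulVec, dotProduct, Finset.sum_eq_zero, smul_zero]
        intro k _
        by_cases hk : n - 1 - m < k
        · rw [ih (by omega) k hk, mul_zero]
        · have : N i k = 0 := by
            by_contra h2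
            have := Fin.lt_def.1 (hN i k h2)
            omega
          rw [this, zero_mul]
    refine ⟨v, h1, ?_, ?_⟩
    · intro m
      induction m with
      | zero =>
        intro _ i hi
        rw [hv0, show i = ⟨n - 1, by omega⟩ from Fin.ext (by simpa using hi), Pi.single_eq_same]
        exact one_ne_zero
      | succ m ih =>
        intro hm i hi
        rw [hvs m hm, Pi.smul_apply, mulVec, dotProduct,
          Finset.sum_eq_single ⟨n - 1 - m, by omega⟩]
        · refine smul_ne_zero (inv_ne_zero (hy m hm)) (mul_ne_zero (hN' _ _ ?_) (ih (by omega) _ rfl))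
          simp only
          omega
        · intro k _ hk
          by_cases hk' : n - 1 - m < k
          · rw [h1 m (by omega) k hk', mul_zero]
          · have : N i k = 0 := by
              by_contra h2
              have := Fin.lt_def.1 (hN i k h2)
              exact hk (Fin.ext (by simp only; omega))
            rw [this, zero_mul]
        · simp
    · intro m i j hj hij
      have hm : m + 1 < n := by omega
      have e1 : i = ⟨n - 1 - (m + 1), by omega⟩ := Fin.ext (by simp only; omega)
      have e2 : j = ⟨n - 1 - m, by omega⟩ := Fin.ext (by simp only; omega)
      rw [hvs m hm, e1, e2, smul_smul, mul_inv_cancel₀ (hy m hm), one_smul]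
  obtain ⟨v, h1, h2, h3⟩ := last
  let B : Matrix (Fin n) (Fin n) K := of fun i j => v (n - 1 - j) i
  have hB : B.BlockTriangular id := by
    intro i j hij
    exact h1 _ (by omega) i (by have := Fin.lt_def.1 hij; simp only [id] at this; omega)
  have hdet : B.det ≠ 0 := by
    rw [Matrix.det_of_isUpperTriangular hB]
    exact Finset.prod_ne_zero_iff.2 fun i _ => h2 _ (by omega) i (by omega)
  refine ⟨GeneralLinearGroup.mkOfDetNeZero B hdet, hB, ?_⟩
  change N * B = B * y
  ext i j
  have hcol : (N * B) i j = (N *ᵥ v (n - 1 - j)) i := rfl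
  rw [hcol, Matrix.mul_apply]
  by_cases hj : (j : ℕ) = 0
  -- The first column of b is supported in the first row, so the strictly upper triangular N kills
  -- it; the first column of y is zero.
  · rw [Finset.sum_eq_zero, mulVec, dotProduct, Finset.sum_eq_zero]
    · intro k _
      by_cases hk : (k : ℕ) = 0
      · have : N i k = 0 := by
          by_contra h4
          have := Fin.lt_def.1 (hN i k h4)
          omega
        rw [this, zero_mul]
      · rw [h1 _ (by omega) k (by omega), mul_zero]
    · intro k _
      have : y k j = 0 := by
        by_contra h4
        have := (h.ne_zero_iff k j).1 h4
        omega
      rw [this, mul_zero]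
  · let j' : Fin n := ⟨j - 1, by omega⟩
    rw [h3 _ j' j (by omega) (by simp only [j']; omega), Finset.sum_eq_single j']
    · rw [Pi.smul_apply, smul_eq_mul, mul_comm]
      congr 1
      change _ = v (n - 1 - (j - 1)) i
      congr 1
      omega
    · intro k _ hk
      have : y k j = 0 := by
        by_contra h4
        have := (h.ne_zero_iff k j).1 h4
        exact hk (Fin.ext (by simp only [j']; omega))
      rw [this, mul_zero]
    · simp

end IndexOne

/-! ### The element `η` and the proof of the theorem -/

namespace IndexOne

open Matrix LieAlgebra LieAlgebra.SpecialLinear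

section RootVectors

variable {K : Type*} [Field K] [CharZero K] {n : ℕ}

/-- A non-zero entry at (k, l) would force ε_k - ε_l = ε_i - ε_j on all diagonal matrices, which
suitable coordinate vectors refute. -/
theorem IsRootVector.apply_eq_zero {i j : Fin n} (hij : i ≠ j) {y : sl (Fin n) K}
    (hy : IsRootVector i j y) {k l : Fin n} (hkl : (k, l) ≠ (i, j)) : y.val k l = 0 := by
  have key : ∀ t : Fin n → K, (t k - t l - (t i - t j)) * y.val k l = 0 := by
    intro t
    -- Subtracting the mean makes the diagonal matrix traceless without changing differences of
    -- entries, so t may be arbitrary.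
    let s : K := (∑ m, t m) / n
    have hn : (n : K) ≠ 0 := by
      have := i.pos
      exact_mod_cast (by omega : n ≠ 0)
    let d : sl (Fin n) K := ⟨diagonal fun m => t m - s, mem_sl_iff.2 (by
      rw [Matrix.trace_diagonal, Finset.sum_sub_distrib, Finset.sum_const, Finset.card_univ,
        Fintype.card_fin, nsmul_eq_mul]
      simp only [s]
      field_simp
      ring)⟩
    have hd : d.val = diagonal fun m => t m - s := rfl
    have h1 := hy.2 d (Matrix.isDiag_diagonal _)
    have h2 : (d.val * y.val - y.val * d.val) k l =
        ((d.val i i - d.val j j) • y.val) k l := by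
      rw [← sl_bracket, h1]
      rfl
    rw [hd, Matrix.sub_apply, diagonal_mul, mul_diagonal, Matrix.smul_apply, diagonal_apply_eq,
      diagonal_apply_eq, smul_eq_mul] at h2
    linear_combination h2
  by_contra h
  have key' : ∀ t : Fin n → K, t k - t l = t i - t j := fun t =>
    sub_eq_zero.1 ((mul_eq_zero.1 (key t)).resolve_right h)
  by_cases hkl' : k = l
  · have := key' (Pi.single i 1)
    rw [hkl', sub_self, Pi.single_eq_same, Pi.single_eq_of_ne hij.symm, sub_zero] at this
    exact zero_ne_one this
  · by_cases hki : k = i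
    · have hlj : l ≠ j := fun h => hkl (by rw [hki, h])
      have := key' (Pi.single l 1)
      rw [Pi.single_eq_of_ne hkl', Pi.single_eq_same, ← hki, Pi.single_eq_of_ne hkl',
        Pi.single_eq_of_ne hlj.symm] at this
      simp at this
    · have := key' (Pi.single k 1)
      rw [Pi.single_eq_same, Pi.single_eq_of_ne (Ne.symm hkl'), Pi.single_eq_of_ne (Ne.symm hki),
        Pi.single_apply] at this
      split_ifs at this
      · exact two_ne_zero (α := K) (by linear_combination this)
      · simp at this

theorem IsRootVector.apply_ne_zero {i j : Fin n} (hij : i ≠ j) {y : sl (Fin n) K}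
    (hy : IsRootVector i j y) : y.val i j ≠ 0 := by
  intro h
  apply hy.1
  apply Subtype.ext
  ext k l
  by_cases hkl : (k, l) = (i, j)
  · simp only [Prod.mk.injEq] at hkl
    rw [hkl.1, hkl.2, h]
    rfl
  · exact hy.apply_eq_zero hij hkl

theorem sum_rootVectors_apply_ne_zero_iff {x : Fin n → Fin n → sl (Fin n) K}
    (hx : ∀ i j, i ≠ j → IsRootVector i j (x i j)) (S : Finset (Fin n × Fin n))
    (hS : ∀ β ∈ S, β.1 ≠ β.2) (i j : Fin n) :
    (∑ β ∈ S, x β.1 β.2).val i j ≠ 0 ↔ (i, j) ∈ S := by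
  have e : (∑ β ∈ S, x β.1 β.2).val i j = ∑ β ∈ S, (x β.1 β.2).val i j := by
    induction S using Finset.induction_on with
    | empty => rfl
    | insert a s ha ih =>
      rw [Finset.sum_insert ha, Finset.sum_insert ha, ← ih fun β hβ =>
        hS β (Finset.mem_insert_of_mem hβ)]
      rfl
  rw [e]
  constructor
  · intro h
    obtain ⟨β, hβ, h1⟩ := Finset.exists_ne_zero_of_sum_ne_zero h
    by_contra h2
    exact h1 ((hx _ _ (hS β hβ)).apply_eq_zero (hS β hβ) fun h3 => h2 (h3 ▸ hβ))
  · intro h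
    rw [Finset.sum_eq_single (i, j)]
    · exact (hx _ _ (hS _ h)).apply_ne_zero (hS _ h)
    · intro β hβ hne
      exact (hx _ _ (hS β hβ)).apply_eq_zero (hS β hβ) (Ne.symm hne)
    · exact fun h' => absurd h h'

theorem isSuperdiagonal_standardNilpotent {x : Fin n → Fin n → sl (Fin n) K}
    (hx : ∀ i j, i ≠ j → IsRootVector i j (x i j)) :
    IsSuperdiagonal (standardNilpotent x).val := by
  refine ⟨fun i j => ?_⟩
  have := sum_rootVectors_apply_ne_zero_iff hx (simpleRoots n) (fun β hβ h => by
    simp [simpleRoots, h] at hβ) i j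
  exact this.trans (by simp [simpleRoots])

theorem eta_apply_ne_zero_iff {p q : ℕ} {x : Fin (p + q) → Fin (p + q) → sl (Fin (p + q)) K}
    (hx : ∀ i j, i ≠ j → IsRootVector i j (x i j)) (i j : Fin (p + q)) :
    (eta p q x).val i j ≠ 0 ↔ CascadeEdge p q i j := by
  rw [← mem_modifiedCascade]
  refine sum_rootVectors_apply_ne_zero_iff hx _ (fun β hβ h => ?_) i j
  have hβ' : (β.1, β.2) ∈ modifiedCascade p q := hβ
  rw [mem_modifiedCascade, h] at hβ'
  unfold CascadeEdge at hβ'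
  omega

end RootVectors

section Permutations

variable {K : Type*} [Field K] {n : ℕ}

/-- The permutation matrix of `w`. -/
def permGL (w : Equiv.Perm (Fin n)) : GL (Fin n) K where
  val := (1 : Matrix (Fin n) (Fin n) K).submatrix w.symm id
  inv := (1 : Matrix (Fin n) (Fin n) K).submatrix id w.symm
  val_inv := by
    ext i j
    simp [mul_apply, one_apply]
  inv_val := by
    rw [submatrix_mul_equiv 1 1 id w.symm id]
    simp

theorem permGL_conj (w : Equiv.Perm (Fin n)) (M : Matrix (Fin n) (Fin n) K) :
    (permGL w).val * M * (permGL w)⁻¹.val = M.submatrix w.symm w.symm := by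
  change (1 : Matrix (Fin n) (Fin n) K).submatrix w.symm id * M *
    (1 : Matrix (Fin n) (Fin n) K).submatrix id w.symm = _
  ext i j
  simp [mul_apply, one_apply]

theorem isWeylRepresentative_permGL (w : Equiv.Perm (Fin n)) :
    IsWeylRepresentative (permGL w : GL (Fin n) K) w := by
  intro t
  rw [permGL_conj]
  ext i j
  simp [diagonal_apply]

end Permutations

variable {K : Type*} [Field K] [CharZero K] {p q : ℕ}

/-! ### Regularity of η, its adapted pair, and its regular nilpotent pre-image -/

section Eta

variable (x : Fin (p + q) → Fin (p + q) → sl (Fin (p + q)) K)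
  (hx : ∀ i j, i ≠ j → IsRootVector i j (x i j))

include hx

theorem finrank_stab_eta (hp : 0 < p) (hq : 0 < q) (hco : Nat.Coprime p q) :
    Module.finrank K (toTriple (eta p q x).val).stab = 1 := by
  let M : ℕ → ℕ → K := fun i j =>
    if h : i < p + q ∧ j < p + q then (eta p q x).val ⟨i, h.1⟩ ⟨j, h.2⟩ else 0
  have hM : ∀ i j : Fin (p + q), M i j = (eta p q x).val i j := fun i j => dif_pos ⟨i.2, j.2⟩
  have h1 : toTriple (eta p q x).val = Triple.ofNat p q M := by
    ext i j
    · exact (hM (Fin.castAdd q i) (Fin.castAdd q j)).symm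
    · exact (hM (Fin.castAdd q i) (Fin.natAdd p j)).symm
    · exact (hM (Fin.natAdd p i) (Fin.natAdd p j)).symm
  rw [h1]
  refine Triple.finrank_stab_ofNat hp hq hco M fun i hi j hj => ?_
  rw [hM ⟨i, hi⟩ ⟨j, hj⟩]
  exact eta_apply_ne_zero_iff hx ⟨i, hi⟩ ⟨j, hj⟩

theorem index_truncatedParabolic (hp : 0 < p) (hq : 0 < q) (hco : Nat.Coprime p q) :
    index K (truncatedParabolic K p q) = 1 := by
  refine le_antisymm ?_ (le_ciInf fun ξ => ?_)
  · refine (ciInf_le (OrderBot.bddBelow _)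
      (restrict (truncatedParabolic K p q) (eta p q x))).trans ?_
    rw [finrank_stabilizer_restrict hp hq, finrank_stab_eta x hx hp hq hco]
  · obtain ⟨y, rfl⟩ := restrict_surjective _ ξ
    rw [finrank_stabilizer_restrict hp hq]
    exact Triple.one_le_finrank_stab hp hq hco _ _ (by simp) (by simp) _

theorem isRegular_restrict_iff (hp : 0 < p) (hq : 0 < q) (hco : Nat.Coprime p q)
    (y : sl (Fin (p + q)) K) :
    IsRegular (restrict (truncatedParabolic K p q) y) ↔
      Module.finrank K (toTriple y.val).stab = 1 := by
  unfold IsRegular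
  rw [index_truncatedParabolic x hx hp hq hco, finrank_stabilizer_restrict hp hq]

theorem existsUnique_isAdaptedPair (hp : 0 < p) (hq : 0 < q) (hco : Nat.Coprime p q) :
    ∃! h : truncatedParabolic K p q,
      h.val.val.IsDiag ∧ IsAdaptedPair h (restrict (truncatedParabolic K p q) (eta p q x)) := by
  have hreg := (isRegular_restrict_iff x hx hp hq hco _).2 (finrank_stab_eta x hx hp hq hco)
  obtain ⟨h, hE, hs, ht⟩ := exists_grading (K := K) hp hq hco 0 0
  rw [Finset.sum_range] at hs ht
  let D : Matrix (Fin (p + q)) (Fin (p + q)) K := diagonal fun i => h i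
  have hA : (toTriple D).A = diagonal fun i : Fin p => h i := by
    ext i j
    change D (Fin.castAdd q i) (Fin.castAdd q j) = _
    simp [D, diagonal_apply]
  have hD : (toTriple D).D = diagonal fun i : Fin q => h (p + i) := by
    ext i j
    change D (Fin.natAdd p i) (Fin.natAdd p j) = _
    simp [D, diagonal_apply]
  have hDA : (toTriple D).A.trace = 0 := by
    rw [hA, Matrix.trace_diagonal, hs]
  have hDD : (toTriple D).D.trace = 0 := by
    rw [hD, Matrix.trace_diagonal, ht]
  let d : sl (Fin (p + q)) K := ⟨D, mem_sl_iff.2 (by rw [← trace_toBlocks, hDA, hDD, add_zero])⟩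
  have hd : d ∈ truncatedParabolic K p q := by
    refine (mem_truncatedParabolic_iff hp hq).2 ⟨blk_toBlocks₁₂_eq_zero_iff.2 ?_, hDA, hDD⟩
    intro i j hi hj
    refine diagonal_apply_ne _ ?_
    rintro rfl
    omega
  have hlie : ⁅d, eta p q x⁆ = - eta p q x := by
    apply Subtype.ext
    rw [sl_bracket]
    change D * (eta p q x).val - (eta p q x).val * D = - (eta p q x).val
    ext i j
    rw [Matrix.sub_apply, diagonal_mul, mul_diagonal, Matrix.neg_apply]
    by_cases h0 : (eta p q x).val i j = 0
    · rw [h0]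
      ring
    · linear_combination (eta p q x).val i j * hE i j ((eta_apply_ne_zero_iff hx i j).1 h0)
  have hpair : ⁅(⟨d, hd⟩ : truncatedParabolic K p q),
      restrict (truncatedParabolic K p q) (eta p q x)⁆ =
      - restrict (truncatedParabolic K p q) (eta p q x) := by
    rw [lie_restrict, hlie, map_neg]
  refine ⟨⟨d, hd⟩, ⟨isDiag_diagonal _, hreg, hpair⟩, ?_⟩
  rintro k ⟨hk, -, hk'⟩
  -- The difference of two solutions is diagonal and annihilates the restriction of η. Its entries
  -- are thus constant along the edges, with zero sum over each block.
  have hz : restrict (truncatedParabolic K p q) ⁅(k.val - d), eta p q x⁆ = 0 := by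
    rw [sub_lie, map_sub, hlie, map_neg, ← lie_restrict, hk', sub_self]
  have hkd : (k.val - d).val = diagonal fun i => k.val.val i i - h i := by
    change k.val.val - D = _
    ext i j
    by_cases hij : i = j
    · subst hij
      simp [D]
    · simp [D, hij, hk hij]
  have hzero : ∀ i < p + q, (fun i : ℕ => if hi : i < p + q then
      k.val.val ⟨i, hi⟩ ⟨i, hi⟩ - h i else 0) i = 0 := by
    obtain ⟨-, hkA, hkD⟩ := truncatedParabolic_le k.2
    refine grading_unique hp hq hco _ ?_ ?_ ?_
    · intro i j hij
      obtain ⟨hi, hj⟩ := hij.lt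
      have hne := (eta_apply_ne_zero_iff hx ⟨i, hi⟩ ⟨j, hj⟩).2 hij
      have h1 := apply_eq_zero_of_restrict_eq_zero hz (i := ⟨i, hi⟩) (j := ⟨j, hj⟩)
        (fun h => by
          have : i = j := congrArg Fin.val h
          subst this
          unfold CascadeEdge at hij
          omega)
        (fun h => not_cascadeEdge_lower h.1 h.2 hij)
      rw [sl_bracket, hkd, Matrix.sub_apply, diagonal_mul, mul_diagonal] at h1
      simp only [hi, hj, dif_pos]
      have h2 : (k.val.val ⟨i, hi⟩ ⟨i, hi⟩ - h i - (k.val.val ⟨j, hj⟩ ⟨j, hj⟩ - h j)) *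
          (eta p q x).val ⟨i, hi⟩ ⟨j, hj⟩ = 0 := by
        linear_combination h1
      exact sub_eq_zero.1 ((mul_eq_zero.1 h2).resolve_right hne)
    · rw [Finset.sum_range, Finset.sum_congr rfl (g := fun i : Fin p =>
        (toTriple k.val.val).A i i - h i), Finset.sum_sub_distrib, hs, sub_zero]
      · exact hkA
      · intro i _
        rw [dif_pos (by omega)]
        rfl
    · rw [Finset.sum_range, Finset.sum_congr rfl (g := fun i : Fin q =>
        (toTriple k.val.val).D i i - h (p + i)), Finset.sum_sub_distrib, ht, sub_zero]
      · exact hkD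
      · intro i _
        rw [dif_pos (by omega)]
        rfl
  apply Subtype.ext
  rw [← sub_eq_zero]
  apply Subtype.ext
  change (k.val - d).val = 0
  rw [hkd, ← diagonal_zero]
  congr 1
  funext i
  have := hzero i i.2
  simpa using this

/-- Adding to `η` a suitable element of the nilradical gives a conjugate of the standard regular
nilpotent element. -/
theorem exists_add_eq_conj (hp : 0 < p) (hq : 0 < q) (hco : Nat.Coprime p q) :
    ∃ ξ ∈ lowerNilradical K p q, ∃ (w : Equiv.Perm (Fin (p + q))) (nw b : GL (Fin (p + q)) K),
      IsWeylRepresentative nw w ∧ b.val.BlockTriangular id ∧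
        eta p q x + ξ = conj nw (conj b (standardNilpotent x)) := by
  obtain ⟨l, hmem, hpw, hch⟩ := exists_chain hp hq hco
  have hnd : l.Nodup := hpw.imp fun h => h.1
  have hlen : l.length = p + q := by
    have : l.toFinset = Finset.range (p + q) := by
      ext k
      simp [hmem]
    rw [← List.toFinset_card_of_nodup hnd, this, Finset.card_range]
  let w₀ : Fin (p + q) → Fin (p + q) := fun k =>
    ⟨l[k]'(by omega), (hmem _).1 (List.getElem_mem _)⟩
  have hw₀ : Function.Injective w₀ := by
    intro a b hab
    have h1 : l[a]'(by omega) = l[b]'(by omega) := congrArg Fin.val hab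
    exact Fin.ext ((hnd.getElem_inj_iff).1 h1)
  let w : Equiv.Perm (Fin (p + q)) := Equiv.ofBijective w₀ hw₀.bijective_of_finite
  have hw : ∀ k, (w k : ℕ) = l[k]'(by omega) := fun k => rfl
  -- A one is placed at each step of the chain that falls in the lower left block, where η is zero.
  -- With the indices listed along the chain, η + ξ then has a non-zero superdiagonal.
  let X : Matrix (Fin (p + q)) (Fin (p + q)) K := of fun a b =>
    if (w.symm b : ℕ) = w.symm a + 1 ∧ (b : ℕ) < p ∧ p ≤ (a : ℕ) then 1 else 0
  have hX : ∀ a b, X a b = if (w.symm b : ℕ) = w.symm a + 1 ∧ (b : ℕ) < p ∧ p ≤ (a : ℕ)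
    then 1 else 0 := fun a b => rfl
  let ξ : sl (Fin (p + q)) K := ⟨X, mem_sl_iff.2 (Finset.sum_eq_zero fun a _ => by
    rw [Matrix.diag_apply, hX, if_neg (by omega)])⟩
  let N : Matrix (Fin (p + q)) (Fin (p + q)) K := (eta p q x + ξ).val.submatrix w w
  have hN : ∀ i j, N i j = (eta p q x).val (w i) (w j) + X (w i) (w j) := fun i j => rfl
  have hup : ∀ i j, N i j ≠ 0 → i < j := by
    intro i j hij
    rw [hN] at hij
    by_cases h1 : (eta p q x).val (w i) (w j) = 0
    · rw [h1, zero_add, hX] at hij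
      have h2 := (ite_ne_right_iff.1 hij).1.1
      simp only [Equiv.symm_apply_apply] at h2
      rw [Fin.lt_def]
      omega
    · have hE := (eta_apply_ne_zero_iff hx _ _).1 h1
      by_contra h2
      rcases (not_lt.1 h2).lt_or_eq with h3 | h3
      · exact (List.pairwise_iff_getElem.1 hpw j i (by omega) (by omega) h3).2 hE
      · subst h3
        unfold CascadeEdge at hE
        omega
  have hsup : ∀ i j : Fin (p + q), (j : ℕ) = i + 1 → N i j ≠ 0 := by
    intro i j hij
    rw [hN, hX]
    simp only [Equiv.symm_apply_apply, hij, true_and]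
    have hstep := List.isChain_iff_getElem.1 hch i (by omega)
    have hj : (w j : ℕ) = l[(i : ℕ) + 1]'(by omega) := by
      rw [hw]
      simp only [hij, Fin.getElem_fin]
    have hi : (w i : ℕ) = l[(i : ℕ)]'(by omega) := hw i
    rw [← hj, ← hi] at hstep
    rcases hstep with h1 | h1
    · have h2 : ¬ ((w j : ℕ) < p ∧ p ≤ (w i : ℕ)) := fun h => not_cascadeEdge_lower h.2 h.1 h1
      rw [if_neg h2, add_zero]
      exact (eta_apply_ne_zero_iff hx _ _).2 h1
    · have h2 : (eta p q x).val (w i) (w j) = 0 := by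
        by_contra h3
        exact not_cascadeEdge_lower h1.2 h1.1 ((eta_apply_ne_zero_iff hx _ _).1 h3)
      rw [h2, zero_add, if_pos h1]
      exact one_ne_zero
  obtain ⟨b, hb, hNb⟩ := (isSuperdiagonal_standardNilpotent hx).exists_conj N hup hsup
  refine ⟨ξ, ?_, w, permGL w, b, isWeylRepresentative_permGL w, hb, ?_⟩
  · intro i j hij
    change X i j = 0
    rw [hX, if_neg]
    exact fun h => hij ⟨h.2.2, h.2.1⟩
  · apply Subtype.ext
    rw [conj_val, conj_val, permGL_conj, ← hNb, mul_assoc, Units.mul_inv, mul_one]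
    ext i j
    simp [N]

end Eta

theorem restrict_add_of_mem_lowerNilradical (hp : 0 < p) (hq : 0 < q) (y : sl (Fin (p + q)) K)
    {ξ : sl (Fin (p + q)) K} (hξ : ξ ∈ lowerNilradical K p q) :
    restrict (truncatedParabolic K p q) (y + ξ) = restrict (truncatedParabolic K p q) y := by
  rw [map_add, add_eq_left, restrict_eq_zero_iff hp hq]
  refine ⟨⟨0, ?_⟩, ?_, 0, ?_⟩
  · ext i j
    rw [zero_smul]
    exact hξ _ _ (by simp)
  · ext i j
    exact hξ _ _ (by simp)
  · ext i j
    rw [zero_smul]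
    exact hξ _ _ (by simp)

theorem isAdapted_toTriple (hp : 0 < p) (hq : 0 < q) {h : truncatedParabolic K p q}
    {y : sl (Fin (p + q)) K} (hy : ⁅h, restrict (truncatedParabolic K p q) y⁆ =
      - restrict (truncatedParabolic K p q) y) : (toTriple y.val).IsAdapted := by
  obtain ⟨μ, ν, hder⟩ := (lie_restrict_eq_smul_iff hp hq h y (-1)).1 (hy.trans (neg_one_smul K _).symm)
  obtain ⟨-, h1, h2⟩ := truncatedParabolic_le h.2
  exact ⟨_, _, _, _, _, hder, 0, by rw [h1, h2]; simp⟩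

/-- An isomorphism of triples comes from an invertible block lower triangular matrix. -/
theorem exists_conj_of_iso (hp : 0 < p) (hq : 0 < q) {y z : sl (Fin (p + q)) K}
    (φ : Triple.Iso (toTriple y.val) (toTriple z.val)) :
    ∃ g : GL (Fin (p + q)) K, restrict (truncatedParabolic K p q) (conj g y) =
      restrict (truncatedParabolic K p q) z := by
  let G : GL (Fin (p + q)) K :=
    { val := unblk (fromBlocks φ.g 0 (φ.f * φ.g) φ.k)
      inv := unblk (fromBlocks φ.g' 0 (-(φ.k' * φ.f)) φ.k')
      val_inv := by
        apply blk_injective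
        rw [blk_mul, blk_unblk, blk_unblk, blk_one]
        simp [fromBlocks_multiply, Matrix.mul_assoc, φ.gg', φ.kk', Triple.cancel_left φ.kk']
      inv_val := by
        apply blk_injective
        rw [blk_mul, blk_unblk, blk_unblk, blk_one]
        simp [fromBlocks_multiply, Matrix.mul_assoc, φ.g'g, φ.k'k] }
  refine ⟨G, ?_⟩
  rw [← sub_eq_zero, ← map_sub, restrict_eq_zero_iff hp hq]
  have e : blk (conj G y - z).val = fromBlocks φ.g 0 (φ.f * φ.g) φ.k * blk y.val *
      fromBlocks φ.g' 0 (-(φ.k' * φ.f)) φ.k' - blk z.val := by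
    change blk (unblk (fromBlocks φ.g 0 (φ.f * φ.g) φ.k) * y.val *
      unblk (fromBlocks φ.g' 0 (-(φ.k' * φ.f)) φ.k') - z.val) = _
    rw [blk_sub, blk_mul, blk_mul, blk_unblk, blk_unblk]
  rw [blk_eq_fromBlocks y.val, blk_eq_fromBlocks z.val, fromBlocks_multiply, fromBlocks_multiply,
    Triple.fromBlocks_sub] at e
  have eA : (toTriple (conj G y - z).val).A = _ := congrArg toBlocks₁₁ e
  have eB : (toTriple (conj G y - z).val).B = _ := congrArg toBlocks₁₂ e
  have eD : (toTriple (conj G y - z).val).D = _ := congrArg toBlocks₂₂ e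
  rw [eA, eB, eD, toBlocks_fromBlocks₁₁, toBlocks_fromBlocks₁₂, toBlocks_fromBlocks₂₂, φ.hA, φ.hB,
    φ.hD]
  refine ⟨⟨φ.μ, ?_⟩, ?_, φ.ν, ?_⟩
  · simp [Matrix.mul_assoc]
    abel
  · simp [Matrix.mul_assoc]
  · simp [Matrix.mul_assoc, Matrix.add_mul]
    abel

end IndexOne

open IndexOne

theorem corollary3p11 {K : Type*} [Field K] [IsAlgClosed K] [CharZero K]
    (p q : ℕ) (hp : 0 < p) (hpq : p < q) (hco : Nat.Coprime p q)
    (x : Fin (p + q) → Fin (p + q) → LieAlgebra.SpecialLinear.sl (Fin (p + q)) K)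
    (hx : ∀ i j, i ≠ j → IsRootVector i j (x i j)) :
    index K (truncatedParabolic K p q) = 1 ∧
    SuggestionHolds (truncatedParabolic K p q) ∧
    (∃! h : truncatedParabolic K p q,
      h.val.val.IsDiag ∧ IsAdaptedPair h (restrict (truncatedParabolic K p q) (eta p q x))) ∧
    ∃ ξ ∈ lowerNilradical K p q,
      restrict (truncatedParabolic K p q) (eta p q x + ξ) =
        restrict (truncatedParabolic K p q) (eta p q x) ∧
      eta p q x + ξ ∈
        regularNilpotents K (LieAlgebra.SpecialLinear.sl (Fin (p + q)) K) ∧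
      ∃ (w : Equiv.Perm (Fin (p + q))) (nw b : GL (Fin (p + q)) K),
        IsWeylRepresentative nw w ∧ b.val.BlockTriangular id ∧
        eta p q x + ξ = conj nw (conj b (standardNilpotent x)) := by
  have hq : 0 < q := hp.trans hpq
  obtain ⟨ξ, hξ, w, nw, b, hw, hb, he⟩ := exists_add_eq_conj x hx hp hq hco
  have hres := restrict_add_of_mem_lowerNilradical hp hq (eta p q x) hξ
  have hsup := isSuperdiagonal_standardNilpotent hx
  have hunique := existsUnique_isAdaptedPair x hx hp hq hco
  refine ⟨index_truncatedParabolic x hx hp hq hco, ?_, hunique, ξ, hξ, hres, ?_, w, nw, b, hw, hb,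
    he⟩
  · rintro h η' ⟨hreg, hlie⟩
    obtain ⟨z, rfl⟩ := restrict_surjective _ η'
    obtain ⟨h₀, ⟨-, -, hlie₀⟩, -⟩ := hunique
    have hy : restrict (truncatedParabolic K p q) (conj nw (conj b (standardNilpotent x))) =
        restrict (truncatedParabolic K p q) (eta p q x) := by rw [← he, hres]
    rw [isRegular_restrict_iff x hx hp hq hco] at hreg
    have hreg₀ := (isRegular_restrict_iff x hx hp hq hco _).2 (finrank_stab_eta x hx hp hq hco)
    rw [← hy] at hlie₀ hreg₀
    rw [isRegular_restrict_iff x hx hp hq hco] at hreg₀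
    -- The isomorphism starts at the triple of n_w b y₀, not of η: the two have the same
    -- restriction, and conjugating the former by the resulting g gives a regular nilpotent
    -- pre-image of η'.
    obtain ⟨φ⟩ := Triple.nonempty_iso_of_isAdapted hp hq hco _ _ _ _ (by simp) (by simp) (by simp)
      (by simp) _ _ hreg₀ hreg (isAdapted_toTriple hp hq hlie₀) (isAdapted_toTriple hp hq hlie)
    obtain ⟨g, hg⟩ := exists_conj_of_iso hp hq φ
    refine ⟨_, hg, ?_⟩
    rw [← IndexOne.conj_mul, ← IndexOne.conj_mul]
    exact hsup.conj_mem _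
  · rw [he, ← IndexOne.conj_mul]
    exact hsup.conj_mem _
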